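/- Let $n$ be a natural number and $\Sigma_n$ the group of permutations of $\{1,\dots,n\}$, with product $(\sigma\tau)(x)=\sigma(\tau(x))$. For a real $n\times n$ matrix $A=(a_{ij})$, the objective function of the Linear Ordering Problem (LOP) with input $A$ is $$f_A:\Sigma_n\to\mathbb{R},\qquad f_A(\sigma)=\sum_{j=1}^{n-1}\sum_{i=j+1}^{n} a_{\sigma(i)\sigma(j)}.$$ For a partition $\lambda\vdash n$ let $\rho_\lambda$ be Young's orthogonal representation of $\Sigma_n$: the real matrix representation with rows and columns indexed by the standard Young tableaux of shape $\lambda$ in which the matrix of the transposition $(k\ \,k+1)$ has the entry $1/d_T$ at $(T,T)$, the entry $\sqrt{1-1/d_T^2}$ at $(S,T)$ if $S\neq T$ arises from $T$ by exchanging $k$ and $k+1$, and the entry $0$ everywhere else, where $d_T=c_T(k+1)-c_T(k)$ and $c_T(m)$ is the column index minus the row index of the cell of $T$ containing $m$. The Fourier coefficient of $f:\Sigma_n\to\mathbb{R}$ at $\lambda$ is the matrix $\hat f_\lambda=\sum_{\sigma\in\Sigma_n} f(\sigma)\rho_\lambda(\sigma)$. **Theorem 1 (Fourier coefficients of the Linear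 Ordering Problem).** 1. For every $A$ and every partition $\lambda\vdash n$ with $\lambda\neq(n),(n-1,1),(n-2,1,1)$ one has $\widehat{(f_A)}_\lambda=0$. 2. Let $\lambda=(n-1,1)$ or $\lambda=(n-2,1,1)$ be a partition of $n$. For every $A$, the matrix $\widehat{(f_A)}_\lambda$ has rank at most one, and it has rank exactly one if and only if it has a nonzero column of which all its columns are scalar multiples. Moreover the proportions among the columns are the same for all instances: there are real numbers $c_{S,T}$ ($S,T$ standard tableaux of shape $\lambda$), which do not depend on $A$, such that for every $A$ and all $S,T$ the column of $\widehat{(f_A)}_\lambda$ indexed by $T$ equals $c_{S,T}$ times the column indexed by $S$. -/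

import Mathlib

/-- Standard Young tableaux of shape `μ` with entries `0, …, n - 1`. A tableau is recorded by the
bijection sending each entry to the cell `(row, column)` that contains it; entries increase along
rows and down columns. -/
abbrev StandardTableau (n : ℕ) (μ : YoungDiagram) : Type :=
  {T : Fin n ≃ μ.cells //
    (∀ a b : Fin n, (T a).1.1 = (T b).1.1 → (T a).1.2 < (T b).1.2 → a < b) ∧
    (∀ a b : Fin n, (T a).1.2 = (T b).1.2 → (T a).1.1 < (T b).1.1 → a < b)}

/-- The content (column minus row) of the cell of `T` that contains the entry `a`. -/
def tableauContent {n : ℕ} {μ : YoungDiagram} (T : StandardTableau n μ) (a : Fin n) : ℤ :=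
  ((T.1 a).1.2 : ℤ) - ((T.1 a).1.1 : ℤ)

/-- The entry `k`, for `k < n - 1`, as an element of `Fin n`. -/
def lowerEntry {n : ℕ} (k : Fin (n - 1)) : Fin n := ⟨k.1, by omega⟩

/-- The entry `k + 1`, for `k < n - 1`, as an element of `Fin n`. -/
def upperEntry {n : ℕ} (k : Fin (n - 1)) : Fin n := ⟨k.1 + 1, by omega⟩

/-- The adjacent transposition `(k  k+1)`. -/
def adjacentSwap {n : ℕ} (k : Fin (n - 1)) : Equiv.Perm (Fin n) :=
  Equiv.swap (lowerEntry k) (upperEntry k)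

/-- The axial distance in `T` from the entry `k` to the entry `k + 1`. -/
def axialDistance {n : ℕ} {μ : YoungDiagram} (T : StandardTableau n μ) (k : Fin (n - 1)) : ℤ :=
  tableauContent T (upperEntry k) - tableauContent T (lowerEntry k)

/-- Young's orthogonal matrix of the adjacent transposition `(k  k+1)`. With `d` the axial distance
from `k` to `k + 1` in `T`, the diagonal entry at `T` is `1 / d`; the entry at `(S, T)`, where `S`
is `T` with `k` and `k + 1` exchanged, is `√(1 - 1 / d²)`; all other entries vanish. -/
noncomputable def youngGenerator (n : ℕ) (μ : YoungDiagram) (k : Fin (n - 1)) :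
    Matrix (StandardTableau n μ) (StandardTableau n μ) ℝ :=
  fun S T =>
    if S = T then 1 / (axialDistance T k : ℝ)
    else if S.1 = (adjacentSwap k).trans T.1 then
      Real.sqrt (1 - 1 / (axialDistance T k : ℝ) ^ 2)
    else 0

/-- Every permutation is a product of adjacent transpositions. -/
theorem exists_adjacentSwap_word {n : ℕ} (σ : Equiv.Perm (Fin n)) :
    ∃ w : List (Fin (n - 1)), (w.map adjacentSwap).prod = σ := by
  cases n with
  | zero => exact ⟨[], Subsingleton.elim _ _⟩
  | succ m =>
    have h : σ ∈ Submonoid.closure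
        (Set.range fun i : Fin m ↦ Equiv.swap i.castSucc i.succ) := by
      rw [Equiv.Perm.mclosure_swap_castSucc_succ]
      trivial
    induction h using Submonoid.closure_induction with
    | mem x hx =>
      obtain ⟨i, rfl⟩ := hx
      exact ⟨[i], List.prod_singleton⟩
    | one => exact ⟨[], rfl⟩
    | mul x y _ _ hx hy =>
      obtain ⟨u, hu⟩ := hx
      obtain ⟨v, hv⟩ := hy
      exact ⟨u ++ v, by rw [List.map_append, List.prod_append, hu, hv]⟩

/-- **Young's orthogonal representation** of the symmetric group, of shape `μ`: the matrix of `σ` is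
the product of Young's orthogonal matrices along a word in the adjacent transpositions whose
product is `σ`. These matrices satisfy the Coxeter relations of the symmetric group, so that the
result does not depend on the word. -/
noncomputable def youngOrthogonalRep (n : ℕ) (μ : YoungDiagram) (σ : Equiv.Perm (Fin n)) :
    Matrix (StandardTableau n μ) (StandardTableau n μ) ℝ :=
  ((exists_adjacentSwap_word σ).choose.map (youngGenerator n μ)).prod

/-- The Fourier coefficient of `f` at the partition `μ`. -/
noncomputable def fourierCoefficient {n : ℕ} (f : Equiv.Perm (Fin n) → ℝ) (μ : YoungDiagram) :
    Matrix (StandardTableau n μ) (StandardTableau n μ) ℝ :=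
  ∑ σ : Equiv.Perm (Fin n), f σ • youngOrthogonalRep n μ σ

/-- The objective function of the linear ordering problem with matrix `A`: the sum of the entries
below the diagonal after reordering rows and columns by `σ`. -/
def lopObjective {n : ℕ} (A : Matrix (Fin n) (Fin n) ℝ) (σ : Equiv.Perm (Fin n)) : ℝ :=
  ∑ j : Fin n, ∑ i ∈ Finset.Ioi j, A (σ i) (σ j)

/-!
The objective is the sum, over positions `j < i`, of the functions `σ ↦ A (σ i) (σ j)`. Right
multiplication of the permutation by `τ` permutes these functions, so a fixed row of the matrices
`pairCoefficient μ A i j = ∑ σ, A (σ i) (σ j) • ρ σ` is a family of vectors indexed by pairs of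
positions, on which Young's representation acts by permuting the pairs. This uses that Young's
matrices satisfy the Coxeter relations, and hence define a representation
(`youngOrthogonalRep_word`). For a nontrivial `μ` only the part antisymmetric in `i` and `j`
contributes (`two_smul_fourierCoefficient`), which leaves an *alternating family*
(`IsAlternatingFamily`). It is determined by its value at the pair of the last two positions, a
vector fixed by the permutations of the other `n - 2` positions and negated by the last adjacent
transposition.

By Young's formulas such a vector is determined by its values at *terminal* tableaux, which have
all entries but the last two in the first row (`IsPairAlternating.eq_zero`). Terminal tableaux
exist only for the shapes `(n - 1, 1)` and `(n - 2, 1, 1)` (`IsTerminal.rowLens_eq`), so the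
Fourier coefficient vanishes at the other nontrivial shapes.

For these two shapes the terminal tableau is unique, so all alternating families are proportional
(`IsAlternatingFamily.proportional`). One of them is explicit: the vectors `e i - e j` of the
standard representation, or `e i ∧ e j` of its exterior square, in Gelfand–Tsetlin coordinates
(`hookPairVector`). Hence every row of the Fourier coefficient is a multiple of the sum `w` of
this family over the pairs `j < i`, whatever the instance. The coordinate of `w` at a tableau is,
up to the nonzero normalisation, `-k (k + 1)` with `k > 0` the entry in the second row
(`sum_range_wedgeCoordinate`). So no coordinate vanishes, and the columns at `S` and `T` are in
the proportion `w S : w T`.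
-/

/-! ### The Coxeter presentation of the symmetric group -/

/-- The product `t j * t (j + 1) * ⋯ * t (j + d - 1)`. -/
def ascendingProd {M : Type*} [Monoid M] (t : ℕ → M) (j d : ℕ) : M :=
  ((List.range' j d).map t).prod

section AscendingProd

variable {M : Type*} [Monoid M] {t : ℕ → M}

theorem ascendingProd_zero (j : ℕ) : ascendingProd t j 0 = 1 := by
  simp [ascendingProd]

theorem ascendingProd_succ (j d : ℕ) :
    ascendingProd t j (d + 1) = t j * ascendingProd t (j + 1) d := by
  simp [ascendingProd, List.range'_succ]

theorem ascendingProd_add (j d e : ℕ) :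
    ascendingProd t j (d + e) = ascendingProd t j d * ascendingProd t (j + d) e := by
  induction d generalizing j with
  | zero => simp [ascendingProd_zero]
  | succ d ih =>
    rw [show d + 1 + e = d + e + 1 by ring, ascendingProd_succ, ih, ascendingProd_succ, mul_assoc,
      show j + 1 + d = j + (d + 1) by ring]

theorem mul_ascendingProd_of_commute {k j d : ℕ}
    (h : ∀ l, j ≤ l → l < j + d → t k * t l = t l * t k) :
    t k * ascendingProd t j d = ascendingProd t j d * t k := by
  induction d generalizing j with
  | zero => simp [ascendingProd_zero]
  | succ d ih =>
    rw [ascendingProd_succ, ← mul_assoc, h j le_rfl (by omega), mul_assoc,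
      ih fun l hl hl' => h l (by omega) (by omega), mul_assoc]

/-- A generator in the interior of an ascending product passes through it with its index lowered
by one; this is where the braid relation enters. -/
theorem mul_ascendingProd_of_braid {N k j d : ℕ}
    (hcomm : ∀ k l, k + 1 < l → l < N → t k * t l = t l * t k)
    (hbraid : ∀ k, k + 1 < N → t k * t (k + 1) * t k = t (k + 1) * t k * t (k + 1))
    (hj : j ≤ k) (hk : k + 1 < j + d) (hN : j + d ≤ N) :
    t (k + 1) * ascendingProd t j d = ascendingProd t j d * t k := by
  obtain ⟨a, rfl⟩ := Nat.exists_eq_add_of_le hj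
  obtain ⟨b, rfl⟩ : ∃ b, d = a + (b + 1 + 1) := ⟨d - a - 2, by omega⟩
  rw [ascendingProd_add, ascendingProd_succ, ascendingProd_succ, ← mul_assoc,
    mul_ascendingProd_of_commute fun l hl hl' => (hcomm l _ (by omega) (by omega)).symm]
  simp only [mul_assoc]
  rw [← mul_ascendingProd_of_commute (k := j + a) fun l hl hl' =>
    hcomm _ l (by omega) (by omega)]
  have := hbraid (j + a) (by omega)
  simp only [← mul_assoc] at this ⊢
  rw [mul_assoc (ascendingProd t j a), mul_assoc (ascendingProd t j a), ← this]
  simp only [mul_assoc]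

end AscendingProd

/-- The transposition of `k` and `k + 1` in the permutations of `ℕ`. -/
def natAdjacentSwap (k : ℕ) : Equiv.Perm ℕ := Equiv.swap k (k + 1)

theorem natAdjacentSwap_mul_self (k : ℕ) : natAdjacentSwap k * natAdjacentSwap k = 1 :=
  Equiv.swap_mul_self _ _

theorem natAdjacentSwap_commute {k l : ℕ} (h : k + 1 < l) :
    natAdjacentSwap k * natAdjacentSwap l = natAdjacentSwap l * natAdjacentSwap k := by
  ext x
  simp only [natAdjacentSwap, Equiv.Perm.mul_apply, Equiv.swap_apply_def]
  split_ifs <;> omega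

theorem natAdjacentSwap_braid (k : ℕ) :
    natAdjacentSwap k * natAdjacentSwap (k + 1) * natAdjacentSwap k =
      natAdjacentSwap (k + 1) * natAdjacentSwap k * natAdjacentSwap (k + 1) := by
  ext x
  simp only [natAdjacentSwap, Equiv.Perm.mul_apply, Equiv.swap_apply_def]
  split_ifs <;> omega

theorem ascendingProd_natAdjacentSwap_apply (j d : ℕ) :
    ascendingProd natAdjacentSwap j d (j + d) = j := by
  induction d generalizing j with
  | zero => simp [ascendingProd_zero]
  | succ d ih =>
    rw [ascendingProd_succ, Equiv.Perm.mul_apply, show j + (d + 1) = j + 1 + d by ring, ih]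
    simp [natAdjacentSwap]

theorem ascendingProd_natAdjacentSwap_apply_of_lt {j d x : ℕ} (hx : j + d < x) :
    ascendingProd natAdjacentSwap j d x = x := by
  induction d generalizing j with
  | zero => simp [ascendingProd_zero]
  | succ d ih =>
    rw [ascendingProd_succ, Equiv.Perm.mul_apply, ih (by omega)]
    exact Equiv.swap_apply_of_ne_of_ne (by omega) (by omega)

/-- If elements `t 0, …, t (n - 1)` of a monoid satisfy the Coxeter relations of the adjacent
transpositions, then multiplication by them lifts to the permutations of `0, …, n`. The lift of `σ`
is built from the coset decomposition `σ = s_j ⋯ s_{n-1} σ'` with `j = σ n` and `σ' n = n`. -/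
theorem exists_lift_natPerm {M : Type*} [Monoid M] (t : ℕ → M) (n : ℕ)
    (hsq : ∀ k, k < n → t k * t k = 1)
    (hcomm : ∀ k l, k + 1 < l → l < n → t k * t l = t l * t k)
    (hbraid : ∀ k, k + 1 < n → t k * t (k + 1) * t k = t (k + 1) * t k * t (k + 1)) :
    ∃ F : Equiv.Perm ℕ → M, F 1 = 1 ∧
      ∀ σ : Equiv.Perm ℕ, (∀ x, n < x → σ x = x) → ∀ k, k < n →
        F (natAdjacentSwap k * σ) = t k * F σ := by
  induction n with
  | zero => exact ⟨fun _ => 1, rfl, fun _ _ k hk => absurd hk (Nat.not_lt_zero k)⟩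
  | succ n ih =>
    obtain ⟨F, hF1, hF⟩ := ih (fun k hk => hsq k (by omega))
      (fun k l h h' => hcomm k l h (by omega)) (fun k hk => hbraid k (by omega))
    -- the coset representative moving `n + 1` to `j`, in the symmetric group and in `M`
    let s : ℕ → Equiv.Perm ℕ := fun j => ascendingProd natAdjacentSwap j (n + 1 - j)
    let u : ℕ → M := fun j => ascendingProd t j (n + 1 - j)
    have hs : ∀ j, j ≤ n → s j = natAdjacentSwap j * s (j + 1) := fun j hj => by
      simp only [s]
      rw [show n + 1 - j = n + 1 - (j + 1) + 1 by omega, ascendingProd_succ]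
    have hu : ∀ j, j ≤ n → u j = t j * u (j + 1) := fun j hj => by
      simp only [u]
      rw [show n + 1 - j = n + 1 - (j + 1) + 1 by omega, ascendingProd_succ]
    refine ⟨fun σ => u (σ (n + 1)) * F ((s (σ (n + 1)))⁻¹ * σ), ?_, ?_⟩
    · simp [u, s, ascendingProd_zero, hF1]
    intro σ hσ k hk
    have hle : σ (n + 1) ≤ n + 1 := by
      by_contra! h
      exact absurd (σ.injective (hσ _ h)) (by omega)
    have hfix : ∀ x, n < x → ((s (σ (n + 1)))⁻¹ * σ) x = x := by
      intro x hx
      rw [Equiv.Perm.mul_apply, Equiv.Perm.inv_eq_iff_eq]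
      rcases (show n + 1 ≤ x from hx).eq_or_lt with rfl | hx
      · have := ascendingProd_natAdjacentSwap_apply (σ (n + 1)) (n + 1 - σ (n + 1))
        rw [Nat.add_sub_cancel' hle] at this
        exact this.symm
      · rw [hσ x hx]
        exact (ascendingProd_natAdjacentSwap_apply_of_lt (by omega)).symm
    have happ : (natAdjacentSwap k * σ) (n + 1) = Equiv.swap k (k + 1) (σ (n + 1)) := rfl
    simp only [happ]
    generalize hj : σ (n + 1) = j at hle hfix
    have hinv : (natAdjacentSwap k)⁻¹ = natAdjacentSwap k := Equiv.swap_inv _ _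
    rcases lt_trichotomy (k + 1) j with h | h | h
    · rw [Equiv.swap_apply_of_ne_of_ne (by omega) (by omega)]
      have h1 : natAdjacentSwap k * s j = s j * natAdjacentSwap k :=
        mul_ascendingProd_of_commute fun l hl _ => natAdjacentSwap_commute (by omega)
      have h2 : t k * u j = u j * t k :=
        mul_ascendingProd_of_commute fun l hl _ => hcomm k l (by omega) (by omega)
      rw [← mul_assoc, show (s j)⁻¹ * natAdjacentSwap k = natAdjacentSwap k * (s j)⁻¹ by
        rw [inv_mul_eq_iff_eq_mul, ← mul_assoc, ← h1, mul_assoc, mul_inv_cancel, mul_one],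
        mul_assoc, hF _ hfix k (by omega), ← mul_assoc, ← h2, mul_assoc]
    · subst h
      rw [Equiv.swap_apply_right, hs k (by omega), hu k (by omega), mul_inv_rev, hinv]
      simp only [mul_assoc]
      rw [← mul_assoc (natAdjacentSwap k), natAdjacentSwap_mul_self, one_mul]
    rcases (show j ≤ k by omega).eq_or_lt with rfl | h'
    · rw [Equiv.swap_apply_left, hs j (by omega), hu j (by omega), mul_inv_rev, hinv]
      simp only [← mul_assoc]
      rw [hsq j hk, one_mul]
    · obtain ⟨k, rfl⟩ : ∃ i, k = i + 1 := ⟨k - 1, by omega⟩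
      rw [Equiv.swap_apply_of_ne_of_ne (by omega) (by omega)]
      have h1 : natAdjacentSwap (k + 1) * s j = s j * natAdjacentSwap k :=
        mul_ascendingProd_of_braid (N := n + 1) (fun _ _ h _ => natAdjacentSwap_commute h)
          (fun _ _ => natAdjacentSwap_braid _) (by omega) (by omega) (by omega)
      have h2 : t (k + 1) * u j = u j * t k :=
        mul_ascendingProd_of_braid hcomm hbraid (by omega) (by omega) (by omega)
      rw [← mul_assoc, show (s j)⁻¹ * natAdjacentSwap (k + 1) = natAdjacentSwap k * (s j)⁻¹ by
        rw [inv_mul_eq_iff_eq_mul, ← mul_assoc, ← h1, mul_assoc, mul_inv_cancel, mul_one],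
        mul_assoc, hF _ hfix k (by omega), ← mul_assoc, ← h2, mul_assoc]

/-- Elements indexed by the adjacent transpositions that satisfy the Coxeter relations define a
map on the symmetric group that is compatible with multiplication by adjacent transpositions. -/
theorem exists_lift_perm {M : Type*} [Monoid M] {n : ℕ} (t : Fin (n - 1) → M)
    (hsq : ∀ k, t k * t k = 1)
    (hcomm : ∀ k l : Fin (n - 1), k.1 + 1 < l.1 → t k * t l = t l * t k)
    (hbraid : ∀ k l : Fin (n - 1), k.1 + 1 = l.1 → t k * t l * t k = t l * t k * t l) :
    ∃ F : Equiv.Perm (Fin n) → M, F 1 = 1 ∧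
      ∀ (σ : Equiv.Perm (Fin n)) (k : Fin (n - 1)), F (adjacentSwap k * σ) = t k * F σ := by
  let t' : ℕ → M := fun k => if h : k < n - 1 then t ⟨k, h⟩ else 1
  have ht' : ∀ k (h : k < n - 1), t' k = t ⟨k, h⟩ := fun k h => dif_pos h
  obtain ⟨F, hF1, hF⟩ := exists_lift_natPerm t' (n - 1)
    (fun k hk => by rw [ht' k hk]; exact hsq _)
    (fun k l h hl => by
      rw [ht' k (by omega), ht' l hl]
      exact hcomm _ _ h)
    (fun k hk => by
      rw [ht' k (by omega), ht' _ hk]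
      exact hbraid _ _ rfl)
  refine ⟨fun σ => F (σ.extendDomain Fin.equivSubtype), by simpa using hF1, fun σ k => ?_⟩
  have hswap : (adjacentSwap k).extendDomain Fin.equivSubtype = natAdjacentSwap k.1 := by
    ext x
    by_cases hx : x < n
    · rw [Equiv.Perm.extendDomain_apply_subtype _ (Fin.equivSubtype (n := n)) hx]
      simp only [adjacentSwap, natAdjacentSwap, Equiv.swap_apply_def, Fin.equivSubtype,
        lowerEntry, upperEntry, Equiv.coe_fn_mk, Equiv.coe_fn_symm_mk, Fin.ext_iff]
      split_ifs <;> rfl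
    · rw [Equiv.Perm.extendDomain_apply_not_subtype _ (Fin.equivSubtype (n := n)) hx]
      have := k.2
      exact (Equiv.swap_apply_of_ne_of_ne (by omega) (by omega)).symm
  have := hF (σ.extendDomain Fin.equivSubtype) (fun x hx =>
    Equiv.Perm.extendDomain_apply_not_subtype _ (Fin.equivSubtype (n := n)) (by omega)) k.1 k.2
  simp only
  rw [← Equiv.Perm.extendDomain_mul, hswap, this, ht' _ k.2]

/-! ### Standard tableaux -/

section Tableaux

variable {n : ℕ} {μ : YoungDiagram}

theorem adjacentSwap_lowerEntry (k : Fin (n - 1)) : adjacentSwap k (lowerEntry k) = upperEntry k :=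
  Equiv.swap_apply_left _ _

theorem adjacentSwap_upperEntry (k : Fin (n - 1)) : adjacentSwap k (upperEntry k) = lowerEntry k :=
  Equiv.swap_apply_right _ _

theorem adjacentSwap_apply_of_ne {k : Fin (n - 1)} {a : Fin n} (h : a.1 ≠ k.1)
    (h' : a.1 ≠ k.1 + 1) : adjacentSwap k a = a :=
  Equiv.swap_apply_of_ne_of_ne (fun e => h (congrArg Fin.val e)) fun e => h' (congrArg Fin.val e)

theorem adjacentSwap_adjacentSwap (k : Fin (n - 1)) (a : Fin n) :
    adjacentSwap k (adjacentSwap k a) = a :=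
  congrArg (fun σ : Equiv.Perm (Fin n) => σ a) (Equiv.swap_mul_self (lowerEntry k) (upperEntry k))

theorem adjacentSwap_apply_val (k : Fin (n - 1)) (a : Fin n) :
    (adjacentSwap k a).1 = if a.1 = k.1 then k.1 + 1 else if a.1 = k.1 + 1 then k.1 else a.1 := by
  unfold adjacentSwap
  rw [Equiv.swap_apply_def]
  simp only [Fin.ext_iff, lowerEntry, upperEntry]
  split_ifs <;> rfl

theorem adjacentSwap_commute {k l : Fin (n - 1)} (h : k.1 + 1 < l.1) (a : Fin n) :
    adjacentSwap k (adjacentSwap l a) = adjacentSwap l (adjacentSwap k a) := by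
  ext
  simp only [adjacentSwap_apply_val]
  split_ifs <;> omega

theorem adjacentSwap_braid {k l : Fin (n - 1)} (h : k.1 + 1 = l.1) (a : Fin n) :
    adjacentSwap l (adjacentSwap k (adjacentSwap l a)) =
      adjacentSwap k (adjacentSwap l (adjacentSwap k a)) := by
  ext
  simp only [adjacentSwap_apply_val, ← h]
  split_ifs <;> omega

theorem adjacentSwap_trans_self {α : Type*} (k : Fin (n - 1)) (T : Fin n ≃ α) :
    (adjacentSwap k).trans ((adjacentSwap k).trans T) = T :=
  Equiv.ext fun a => congrArg T (adjacentSwap_adjacentSwap k a)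

theorem lowerEntry_ne_upperEntry (k : Fin (n - 1)) : lowerEntry k ≠ upperEntry k :=
  fun h => absurd (congrArg Fin.val h) (Nat.ne_of_lt (Nat.lt_succ_self k.1))

namespace StandardTableau

variable (T : StandardTableau n μ)

theorem exists_entry {i j : ℕ} (h : (i, j) ∈ μ) : ∃ a, (T.1 a).1 = (i, j) :=
  ⟨T.1.symm ⟨(i, j), (YoungDiagram.mem_cells _).2 h⟩, by rw [Equiv.apply_symm_apply]⟩

theorem mem (a : Fin n) : ((T.1 a).1.1, (T.1 a).1.2) ∈ μ :=
  (YoungDiagram.mem_cells _).1 (T.1 a).2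

theorem eq_of_cell_eq {a b : Fin n} (h : (T.1 a).1.1 = (T.1 b).1.1)
    (h' : (T.1 a).1.2 = (T.1 b).1.2) : a = b :=
  T.1.injective (Subtype.ext (Prod.ext h h'))

theorem le_of_row {a b : Fin n} (h : (T.1 a).1.1 = (T.1 b).1.1)
    (h' : (T.1 a).1.2 ≤ (T.1 b).1.2) : a ≤ b := by
  rcases h'.lt_or_eq with h' | h'
  · exact (T.2.1 a b h h').le
  · exact (T.eq_of_cell_eq h h').le

theorem le_of_col {a b : Fin n} (h : (T.1 a).1.2 = (T.1 b).1.2)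
    (h' : (T.1 a).1.1 ≤ (T.1 b).1.1) : a ≤ b := by
  rcases h'.lt_or_eq with h' | h'
  · exact (T.2.2 a b h h').le
  · exact (T.eq_of_cell_eq h' h).le

/-- The rectangle spanned by the cells of `a` and `b` has two further corners, whose entries lie
strictly between `a` and `b`. -/
theorem exists_two_between {a b : Fin n} (h : (T.1 a).1.1 < (T.1 b).1.1)
    (h' : (T.1 a).1.2 < (T.1 b).1.2) : a.1 + 3 ≤ b.1 := by
  obtain ⟨x, hx⟩ := T.exists_entry (μ.up_left_mem h.le le_rfl (T.mem b))
  obtain ⟨y, hy⟩ := T.exists_entry (μ.up_left_mem le_rfl h'.le (T.mem b))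
  have hax : a < x := T.2.1 a x (by rw [hx]) (by rw [hx]; exact h')
  have hxb : x < b := T.2.2 x b (by rw [hx]) (by rw [hx]; exact h)
  have hay : a < y := T.2.2 a y (by rw [hy]) (by rw [hy]; exact h)
  have hyb : y < b := T.2.1 y b (by rw [hy]) (by rw [hy]; exact h')
  have hxy : x.1 ≠ y.1 := fun e => by
    rw [Fin.ext e, hy, Prod.mk.injEq] at hx
    omega
  simp only [Fin.lt_def] at hax hxb hay hyb
  omega

/-- Entries on a common diagonal differ by at least `3`, since the two corners of the rectangle that
they span carry entries between them. -/
theorem content_ne {a b : Fin n} (h : a < b) (h' : b.1 ≤ a.1 + 2) :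
    tableauContent T a ≠ tableauContent T b := by
  intro e
  unfold tableauContent at e
  rcases lt_trichotomy (T.1 a).1.1 (T.1 b).1.1 with hr | hr | hr
  · have := T.exists_two_between hr (by omega)
    omega
  · exact h.ne (T.eq_of_cell_eq hr (by omega))
  · have := T.exists_two_between hr (by omega)
    rw [Fin.lt_def] at h
    omega

theorem axialDistance_ne_zero (k : Fin (n - 1)) : axialDistance T k ≠ 0 :=
  sub_ne_zero.2 (T.content_ne (a := lowerEntry k) (b := upperEntry k) (Nat.lt_succ_self _)
    (Nat.le_succ _)).symm

theorem axialDistance_of_row_eq {k : Fin (n - 1)}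
    (h : (T.1 (lowerEntry k)).1.1 = (T.1 (upperEntry k)).1.1) : axialDistance T k = 1 := by
  have hlt : (T.1 (lowerEntry k)).1.2 < (T.1 (upperEntry k)).1.2 := by
    by_contra! hle
    exact absurd (T.le_of_row h.symm hle) (Nat.not_le.2 (Nat.lt_succ_self k.1))
  obtain ⟨x, hx⟩ := T.exists_entry (μ.up_left_mem le_rfl hlt (T.mem (upperEntry k)))
  have h1 : lowerEntry k < x := T.2.1 _ _ (by rw [hx, h]) (by rw [hx]; exact Nat.lt_succ_self _)
  have h2 : upperEntry k ≤ x := h1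
  have h3 : x ≤ upperEntry k := T.le_of_row (by rw [hx]) (by rw [hx]; exact hlt)
  rw [le_antisymm h3 h2] at hx
  have h4 := congrArg Prod.snd hx
  unfold axialDistance tableauContent
  simp only at h4
  omega

theorem axialDistance_of_col_eq {k : Fin (n - 1)}
    (h : (T.1 (lowerEntry k)).1.2 = (T.1 (upperEntry k)).1.2) : axialDistance T k = -1 := by
  have hlt : (T.1 (lowerEntry k)).1.1 < (T.1 (upperEntry k)).1.1 := by
    by_contra! hle
    exact absurd (T.le_of_col h.symm hle) (Nat.not_le.2 (Nat.lt_succ_self k.1))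
  obtain ⟨x, hx⟩ := T.exists_entry (μ.up_left_mem hlt le_rfl (T.mem (upperEntry k)))
  have h1 : lowerEntry k < x := T.2.2 _ _ (by rw [hx, h]) (by rw [hx]; exact Nat.lt_succ_self _)
  have h2 : upperEntry k ≤ x := h1
  have h3 : x ≤ upperEntry k := T.le_of_col (by rw [hx]) (by rw [hx]; exact hlt)
  rw [le_antisymm h3 h2] at hx
  have h4 := congrArg Prod.fst hx
  unfold axialDistance tableauContent
  simp only at h4
  omega

theorem swap_lt {k : Fin (n - 1)} {a b : Fin n} (h : adjacentSwap k a < adjacentSwap k b)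
    (hne : ¬ (adjacentSwap k a = lowerEntry k ∧ adjacentSwap k b = upperEntry k)) : a < b := by
  by_contra! hle
  apply hne
  by_cases ha : a.1 = k.1 + 1
  · by_cases hb : b.1 = k.1
    · rw [show a = upperEntry k from Fin.ext ha, show b = lowerEntry k from Fin.ext hb]
      exact ⟨adjacentSwap_upperEntry k, adjacentSwap_lowerEntry k⟩
    · rw [show a = upperEntry k from Fin.ext ha, adjacentSwap_upperEntry] at h
      by_cases hb' : b.1 = k.1 + 1
      · rw [show b = upperEntry k from Fin.ext hb', adjacentSwap_upperEntry] at h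
        exact absurd h (lt_irrefl _)
      · rw [adjacentSwap_apply_of_ne hb hb'] at h
        simp only [Fin.lt_def, Fin.le_def, lowerEntry] at h hle
        omega
  · by_cases ha' : a.1 = k.1
    · rw [show a = lowerEntry k from Fin.ext ha', adjacentSwap_lowerEntry] at h
      by_cases hb : b.1 = k.1
      · rw [show b = lowerEntry k from Fin.ext hb, adjacentSwap_lowerEntry] at h
        exact absurd h (lt_irrefl _)
      · rw [adjacentSwap_apply_of_ne hb (by rw [Fin.le_def] at hle; omega)] at h
        simp only [Fin.lt_def, Fin.le_def, upperEntry] at h hle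
        omega
    · rw [adjacentSwap_apply_of_ne ha' ha] at h
      by_cases hb : b.1 = k.1
      · rw [show b = lowerEntry k from Fin.ext hb, adjacentSwap_lowerEntry] at h
        simp only [Fin.lt_def, Fin.le_def, upperEntry] at h hle
        omega
      · by_cases hb' : b.1 = k.1 + 1
        · rw [show b = upperEntry k from Fin.ext hb', adjacentSwap_upperEntry] at h
          simp only [Fin.lt_def, Fin.le_def, lowerEntry] at h hle
          omega
        · rw [adjacentSwap_apply_of_ne hb hb'] at h
          exact absurd hle (not_le.2 h)

/-- Exchanging `k` and `k + 1` preserves standardness unless they are neighbours in a row or a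
column, in which case the off-diagonal entry of Young's matrix vanishes. -/
theorem swap_standard_or (k : Fin (n - 1)) :
    (∃ S : StandardTableau n μ, S.1 = (adjacentSwap k).trans T.1) ∨
      axialDistance T k = 1 ∨ axialDistance T k = -1 := by
  by_cases hr : (T.1 (lowerEntry k)).1.1 = (T.1 (upperEntry k)).1.1
  · exact Or.inr (Or.inl (T.axialDistance_of_row_eq hr))
  by_cases hc : (T.1 (lowerEntry k)).1.2 = (T.1 (upperEntry k)).1.2
  · exact Or.inr (Or.inr (T.axialDistance_of_col_eq hc))
  refine Or.inl ⟨⟨(adjacentSwap k).trans T.1, fun a b h h' => ?_, fun a b h h' => ?_⟩, rfl⟩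
  · refine swap_lt (T.2.1 _ _ h h') fun e => hr ?_
    rw [← e.1, ← e.2]
    exact h
  · refine swap_lt (T.2.2 _ _ h h') fun e => hc ?_
    rw [← e.1, ← e.2]
    exact h

/-- The column of an entry counts the smaller entries in its row. -/
theorem col_eq_card (a : Fin n) :
    (T.1 a).1.2 = (Finset.univ.filter fun b => b < a ∧ (T.1 b).1.1 = (T.1 a).1.1).card := by
  symm
  rw [← Finset.card_range (T.1 a).1.2]
  refine Finset.card_bij (fun b _ => (T.1 b).1.2) (fun b hb => ?_) (fun b hb c hc h => ?_)
    fun j hj => ?_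
  · simp only [Finset.mem_filter, Finset.mem_univ, true_and] at hb
    rw [Finset.mem_range]
    by_contra! hle
    exact absurd (T.le_of_row hb.2.symm hle) (not_le.2 hb.1)
  · simp only [Finset.mem_filter, Finset.mem_univ, true_and] at hb hc
    exact T.eq_of_cell_eq (hb.2.trans hc.2.symm) h
  · rw [Finset.mem_range] at hj
    obtain ⟨b, hb⟩ := T.exists_entry (μ.up_left_mem le_rfl hj.le (T.mem a))
    refine ⟨b, ?_, by rw [hb]⟩
    simp only [Finset.mem_filter, Finset.mem_univ, true_and]
    exact ⟨T.2.1 _ _ (by rw [hb]) (by rw [hb]; exact hj), by rw [hb]⟩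

theorem rowLen_eq_card (i : ℕ) :
    μ.rowLen i = (Finset.univ.filter fun a => (T.1 a).1.1 = i).card := by
  rw [YoungDiagram.rowLen_eq_card]
  symm
  refine Finset.card_bij (fun b _ => (T.1 b).1) (fun b hb => ?_)
    (fun b _ c _ h => T.1.injective (Subtype.ext h)) fun c hc => ?_
  · exact YoungDiagram.mem_row_iff.2 ⟨T.mem b, (Finset.mem_filter.1 hb).2⟩
  · obtain ⟨h1, h2⟩ := YoungDiagram.mem_row_iff.1 hc
    obtain ⟨a, ha⟩ := T.exists_entry (i := c.1) (j := c.2) h1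
    exact ⟨a, by simp [ha, h2], ha⟩

end StandardTableau

end Tableaux

/-! ### Young's orthogonal matrices satisfy the Coxeter relations -/

section YoungOperator

variable {n : ℕ} {μ : YoungDiagram}

/-- The content of the cell holding `a` in a filling that need not be standard. -/
def fillingContent (T : Fin n ≃ μ.cells) (a : Fin n) : ℤ := ((T a).1.2 : ℤ) - ((T a).1.1 : ℤ)

/-- The axial distance from `k` to `k + 1` in a filling that need not be standard. -/
def fillingDistance (T : Fin n ≃ μ.cells) (k : Fin (n - 1)) : ℤ :=
  fillingContent T (upperEntry k) - fillingContent T (lowerEntry k)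

/-- Young's orthogonal matrix of `(k  k+1)` as an operator on functions of all fillings of the
diagram. Its values at the standard tableaux depend only on the values there of its argument, so
relations between Young's matrices may be checked without regard to standardness. -/
noncomputable def youngOperator (k : Fin (n - 1)) (F : (Fin n ≃ μ.cells) → ℝ) :
    (Fin n ≃ μ.cells) → ℝ := fun T =>
  (fillingDistance T k : ℝ)⁻¹ * F T +
    Real.sqrt (1 - ((fillingDistance T k : ℝ)⁻¹) ^ 2) * F ((adjacentSwap k).trans T)

theorem youngGenerator_mulVec (k : Fin (n - 1)) (F : (Fin n ≃ μ.cells) → ℝ) :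
    (youngGenerator n μ k).mulVec (fun T => F T.1) = fun T => youngOperator k F T.1 := by
  funext T
  have hoff : ∀ S : StandardTableau n μ, S ≠ T → S.1 ≠ (adjacentSwap k).trans T.1 →
      youngGenerator n μ k T S * F S.1 = 0 := by
    intro S hS hS'
    unfold youngGenerator
    rw [if_neg hS.symm, if_neg, zero_mul]
    intro h
    apply hS'
    rw [h, adjacentSwap_trans_self]
  have hdiag : youngGenerator n μ k T T = (fillingDistance T.1 k : ℝ)⁻¹ := by
    unfold youngGenerator
    rw [if_pos rfl, one_div]
    rfl
  have hfix : (adjacentSwap k).trans T.1 ≠ T.1 := by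
    intro h
    have := T.1.injective (Equiv.congr_fun h (lowerEntry k))
    rw [adjacentSwap_lowerEntry] at this
    exact lowerEntry_ne_upperEntry k this.symm
  have hmul : (youngGenerator n μ k).mulVec (fun T => F T.1) T =
      ∑ S : StandardTableau n μ, youngGenerator n μ k T S * F S.1 := rfl
  rw [hmul]
  unfold youngOperator
  by_cases hS : ∃ S : StandardTableau n μ, S.1 = (adjacentSwap k).trans T.1
  · obtain ⟨S, hS⟩ := hS
    have hST : S ≠ T := fun h => hfix (by rw [← hS, h])
    have hTS : T.1 = (adjacentSwap k).trans S.1 := by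
      rw [hS, adjacentSwap_trans_self]
    have hdist : axialDistance S k = - axialDistance T k := by
      unfold axialDistance tableauContent
      simp only [hS, Equiv.trans_apply, adjacentSwap_lowerEntry, adjacentSwap_upperEntry]
      ring
    rw [Finset.sum_eq_add_of_mem T S (Finset.mem_univ _) (Finset.mem_univ _) hST.symm
      fun R _ hR => hoff R hR.1 fun h => hR.2 (Subtype.ext (h.trans hS.symm)), hdiag, ← hS]
    congr 2
    unfold youngGenerator
    rw [if_neg hST.symm, if_pos hTS, hdist]
    simp only [Int.cast_neg, neg_sq, one_div, inv_pow]
    rfl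
  · have hsq : Real.sqrt (1 - ((fillingDistance T.1 k : ℝ)⁻¹) ^ 2) = 0 := by
      change Real.sqrt (1 - ((axialDistance T k : ℝ)⁻¹) ^ 2) = 0
      rcases T.swap_standard_or k with h | h | h
      · exact absurd h hS
      · rw [h]; simp
      · rw [h]; simp
    rw [Finset.sum_eq_single_of_mem T (Finset.mem_univ _)
      fun R _ hR => hoff R hR fun h => hS ⟨R, h⟩, hdiag, hsq, zero_mul, add_zero]

theorem fillingContent_trans (σ : Equiv.Perm (Fin n)) (T : Fin n ≃ μ.cells) (a : Fin n) :
    fillingContent (σ.trans T) a = fillingContent T (σ a) := rfl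

theorem sq_sqrt_one_sub_inv_sq {d : ℤ} (hd : d ≠ 0) :
    Real.sqrt (1 - ((d : ℝ)⁻¹) ^ 2) ^ 2 = 1 - ((d : ℝ)⁻¹) ^ 2 := by
  apply Real.sq_sqrt
  have h : (1 : ℝ) ≤ |(d : ℝ)| := by exact_mod_cast Int.one_le_abs hd
  rw [sub_nonneg, inv_pow, ← sq_abs]
  exact inv_le_one_of_one_le₀ (one_le_pow₀ h)

theorem fillingDistance_swap (k : Fin (n - 1)) (T : Fin n ≃ μ.cells) :
    fillingDistance ((adjacentSwap k).trans T) k = -fillingDistance T k := by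
  simp only [fillingDistance, fillingContent_trans, adjacentSwap_lowerEntry,
    adjacentSwap_upperEntry, neg_sub]

theorem youngOperator_sq (k : Fin (n - 1)) (F : (Fin n ≃ μ.cells) → ℝ) {T : Fin n ≃ μ.cells}
    (h : fillingDistance T k ≠ 0) : youngOperator k (youngOperator k F) T = F T := by
  simp only [youngOperator, fillingDistance_swap, adjacentSwap_trans_self, Int.cast_neg, inv_neg,
    neg_sq]
  linear_combination F T * sq_sqrt_one_sub_inv_sq h

theorem youngOperator_comm {k l : Fin (n - 1)} (hkl : k.1 + 1 < l.1)
    (F : (Fin n ≃ μ.cells) → ℝ) (T : Fin n ≃ μ.cells) :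
    youngOperator k (youngOperator l F) T = youngOperator l (youngOperator k F) T := by
  have h1 : adjacentSwap k (lowerEntry l) = lowerEntry l :=
    adjacentSwap_apply_of_ne (by simp only [lowerEntry]; omega) (by simp only [lowerEntry]; omega)
  have h2 : adjacentSwap k (upperEntry l) = upperEntry l :=
    adjacentSwap_apply_of_ne (by simp only [upperEntry]; omega) (by simp only [upperEntry]; omega)
  have h3 : adjacentSwap l (lowerEntry k) = lowerEntry k :=
    adjacentSwap_apply_of_ne (by simp only [lowerEntry]; omega) (by simp only [lowerEntry]; omega)
  have h4 : adjacentSwap l (upperEntry k) = upperEntry k :=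
    adjacentSwap_apply_of_ne (by simp only [upperEntry]; omega) (by simp only [upperEntry]; omega)
  have hT : (adjacentSwap l).trans ((adjacentSwap k).trans T) =
      (adjacentSwap k).trans ((adjacentSwap l).trans T) :=
    Equiv.ext fun a => congrArg T (adjacentSwap_commute hkl a)
  simp only [youngOperator, fillingDistance, fillingContent_trans, h1, h2, h3, h4, hT]
  ring

theorem youngOperator_braid {k l : Fin (n - 1)} (hkl : k.1 + 1 = l.1)
    (F : (Fin n ≃ μ.cells) → ℝ) {T : Fin n ≃ μ.cells} (hk : fillingDistance T k ≠ 0)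
    (hl : fillingDistance T l ≠ 0) (hkl' : fillingDistance T k + fillingDistance T l ≠ 0) :
    youngOperator k (youngOperator l (youngOperator k F)) T =
      youngOperator l (youngOperator k (youngOperator l F)) T := by
  have hlow : lowerEntry l = upperEntry k := Fin.ext hkl.symm
  have h1 : adjacentSwap k (upperEntry l) = upperEntry l :=
    adjacentSwap_apply_of_ne (by simp only [upperEntry]; omega) (by simp only [upperEntry]; omega)
  have h2 : adjacentSwap l (lowerEntry k) = lowerEntry k :=
    adjacentSwap_apply_of_ne (by simp only [lowerEntry]; omega) (by simp only [lowerEntry]; omega)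
  have h3 : adjacentSwap l (upperEntry k) = upperEntry l := by rw [← hlow, adjacentSwap_lowerEntry]
  have h4 : adjacentSwap l (upperEntry l) = upperEntry k := by rw [adjacentSwap_upperEntry, hlow]
  have hT : (adjacentSwap l).trans ((adjacentSwap k).trans ((adjacentSwap l).trans T)) =
      (adjacentSwap k).trans ((adjacentSwap l).trans ((adjacentSwap k).trans T)) :=
    Equiv.ext fun a => congrArg T (adjacentSwap_braid hkl a)
  have hx := sq_sqrt_one_sub_inv_sq hk
  have hy := sq_sqrt_one_sub_inv_sq hl
  have hz := sq_sqrt_one_sub_inv_sq hkl'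
  have hxyz : ((fillingDistance T k : ℤ) : ℝ)⁻¹ * ((fillingDistance T l : ℤ) : ℝ)⁻¹ =
      (((fillingDistance T k + fillingDistance T l : ℤ)) : ℝ)⁻¹ *
        (((fillingDistance T k : ℤ) : ℝ)⁻¹ + ((fillingDistance T l : ℤ) : ℝ)⁻¹) := by
    have a1 : ((fillingDistance T k : ℤ) : ℝ) ≠ 0 := by exact_mod_cast hk
    have a2 : ((fillingDistance T l : ℤ) : ℝ) ≠ 0 := by exact_mod_cast hl
    have a3 : ((fillingDistance T k : ℤ) : ℝ) + ((fillingDistance T l : ℤ) : ℝ) ≠ 0 := by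
      exact_mod_cast hkl'
    push_cast
    field_simp
    ring
  -- axial distances in the fillings that arise from `T` by permuting `k`, `k + 1`, `k + 2`
  have e1 : fillingDistance ((adjacentSwap k).trans T) l =
      fillingDistance T k + fillingDistance T l := by
    simp only [fillingDistance, fillingContent_trans, hlow, h1, adjacentSwap_upperEntry]
    ring
  have e2 : fillingDistance ((adjacentSwap l).trans T) k =
      fillingDistance T k + fillingDistance T l := by
    simp only [fillingDistance, fillingContent_trans, hlow, h2, h3]
    ring
  have e3 : fillingDistance ((adjacentSwap l).trans ((adjacentSwap k).trans T)) k =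
      fillingDistance T l := by
    simp only [fillingDistance, fillingContent_trans, hlow, h1, h2, h3, adjacentSwap_lowerEntry]
  have e4 : fillingDistance ((adjacentSwap k).trans ((adjacentSwap l).trans T)) l =
      fillingDistance T k := by
    simp only [fillingDistance, fillingContent_trans, hlow, h1, h2, h4, adjacentSwap_upperEntry]
  simp only [youngOperator, e1, e2, e3, e4, fillingDistance_swap, adjacentSwap_trans_self,
    Int.cast_neg, inv_neg, neg_sq, hT]
  generalize Real.sqrt (1 - ((fillingDistance T k : ℝ)⁻¹) ^ 2) = p at *
  generalize Real.sqrt (1 - ((fillingDistance T l : ℝ)⁻¹) ^ 2) = q at *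
  generalize Real.sqrt (1 - (((fillingDistance T k + fillingDistance T l : ℤ) : ℝ)⁻¹) ^ 2) = r at *
  generalize ((fillingDistance T k : ℝ)⁻¹) = x at *
  generalize ((fillingDistance T l : ℝ)⁻¹) = y at *
  generalize (((fillingDistance T k + fillingDistance T l : ℤ) : ℝ)⁻¹) = z at *
  linear_combination (F T * (x - y) + F ((adjacentSwap k).trans T) * p -
    F ((adjacentSwap l).trans T) * q) * hxyz + F T * z * hx - F T * z * hy

theorem eq_of_mulVec_filling {M N : Matrix (StandardTableau n μ) (StandardTableau n μ) ℝ}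
    (h : ∀ F : (Fin n ≃ μ.cells) → ℝ, M.mulVec (fun T => F T.1) = N.mulVec fun T => F T.1) :
    M = N := by
  apply Matrix.mulVec_injective
  funext v
  have hv : (fun T : StandardTableau n μ => Function.extend Subtype.val v 0 T.1) = v :=
    funext fun T => Subtype.val_injective.extend_apply v 0 T
  rw [← hv]
  exact h _

theorem youngGenerator_mul_self (k : Fin (n - 1)) :
    youngGenerator n μ k * youngGenerator n μ k = 1 := by
  refine eq_of_mulVec_filling fun F => ?_
  rw [← Matrix.mulVec_mulVec, youngGenerator_mulVec, youngGenerator_mulVec, Matrix.one_mulVec]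
  exact funext fun T => youngOperator_sq k F (T.axialDistance_ne_zero k)

theorem youngGenerator_comm {k l : Fin (n - 1)} (h : k.1 + 1 < l.1) :
    youngGenerator n μ k * youngGenerator n μ l = youngGenerator n μ l * youngGenerator n μ k := by
  refine eq_of_mulVec_filling fun F => ?_
  simp only [← Matrix.mulVec_mulVec, youngGenerator_mulVec]
  exact funext fun T => youngOperator_comm h F T.1

theorem youngGenerator_braid {k l : Fin (n - 1)} (h : k.1 + 1 = l.1) :
    youngGenerator n μ k * youngGenerator n μ l * youngGenerator n μ k =
      youngGenerator n μ l * youngGenerator n μ k * youngGenerator n μ l := by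
  refine eq_of_mulVec_filling fun F => ?_
  simp only [← Matrix.mulVec_mulVec, youngGenerator_mulVec]
  refine funext fun T => youngOperator_braid h F (T.axialDistance_ne_zero k)
    (T.axialDistance_ne_zero l) ?_
  have hlow : lowerEntry l = upperEntry k := Fin.ext h.symm
  have := T.content_ne (a := lowerEntry k) (b := upperEntry l)
    (by simp only [Fin.lt_def, lowerEntry, upperEntry]; omega)
    (by simp only [lowerEntry, upperEntry]; omega)
  simp only [fillingDistance, hlow]
  change tableauContent T _ - tableauContent T _ + (tableauContent T _ - tableauContent T _) ≠ 0
  intro e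
  exact this (by linarith)

end YoungOperator

section YoungRep

variable {n : ℕ} {μ : YoungDiagram}

/-- The matrix of a product of adjacent transpositions does not depend on the chosen word. -/
theorem youngOrthogonalRep_word (w : List (Fin (n - 1))) :
    youngOrthogonalRep n μ (w.map adjacentSwap).prod = (w.map (youngGenerator n μ)).prod := by
  obtain ⟨F, hF1, hF⟩ := exists_lift_perm (youngGenerator n μ) youngGenerator_mul_self
    (fun _ _ => youngGenerator_comm) fun _ _ => youngGenerator_braid
  have key : ∀ v : List (Fin (n - 1)),
      (v.map (youngGenerator n μ)).prod = F (v.map adjacentSwap).prod := by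
    intro v
    induction v with
    | nil => simp [hF1]
    | cons k v ih => rw [List.map_cons, List.prod_cons, List.map_cons, List.prod_cons, hF, ih]
  unfold youngOrthogonalRep
  rw [key, (exists_adjacentSwap_word _).choose_spec, key]

theorem youngOrthogonalRep_mul_adjacentSwap (σ : Equiv.Perm (Fin n)) (k : Fin (n - 1)) :
    youngOrthogonalRep n μ (σ * adjacentSwap k) =
      youngOrthogonalRep n μ σ * youngGenerator n μ k := by
  obtain ⟨w, rfl⟩ := exists_adjacentSwap_word σ
  have : (w.map adjacentSwap).prod * adjacentSwap k = ((w ++ [k]).map adjacentSwap).prod := by simp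
  rw [this, youngOrthogonalRep_word, youngOrthogonalRep_word]
  simp

theorem youngGenerator_transpose (k : Fin (n - 1)) :
    (youngGenerator n μ k).transpose = youngGenerator n μ k := by
  ext S T
  rw [Matrix.transpose_apply]
  unfold youngGenerator
  by_cases h : S = T
  · rw [h]
  rw [if_neg h, if_neg (Ne.symm h)]
  by_cases h' : S.1 = (adjacentSwap k).trans T.1
  · have hT : T.1 = (adjacentSwap k).trans S.1 := by rw [h', adjacentSwap_trans_self]
    have hdist : axialDistance S k = - axialDistance T k := by
      unfold axialDistance tableauContent
      simp only [h', Equiv.trans_apply, adjacentSwap_lowerEntry, adjacentSwap_upperEntry]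
      ring
    rw [if_pos h', if_pos hT, hdist, Int.cast_neg, neg_sq]
  · rw [if_neg h', if_neg fun hT => h' (by rw [hT, adjacentSwap_trans_self])]

theorem vecMul_youngGenerator (v : StandardTableau n μ → ℝ) (k : Fin (n - 1)) :
    Matrix.vecMul v (youngGenerator n μ k) = (youngGenerator n μ k).mulVec v := by
  rw [← Matrix.mulVec_transpose, youngGenerator_transpose]

end YoungRep

/-! ### Invariant and alternating vectors -/

section Invariants

variable {n : ℕ} {μ : YoungDiagram}

theorem youngGenerator_mulVec_apply (k : Fin (n - 1)) (v : StandardTableau n μ → ℝ)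
    (T : StandardTableau n μ) :
    (youngGenerator n μ k).mulVec v T = (axialDistance T k : ℝ)⁻¹ * v T +
      Real.sqrt (1 - ((axialDistance T k : ℝ)⁻¹) ^ 2) *
        Function.extend Subtype.val v 0 ((adjacentSwap k).trans T.1) := by
  have h := congrFun (youngGenerator_mulVec k (Function.extend Subtype.val v 0)) T
  have hv : (fun T : StandardTableau n μ => Function.extend Subtype.val v 0 T.1) = v :=
    funext fun T => Subtype.val_injective.extend_apply v 0 T
  rw [hv] at h
  rw [h]
  unfold youngOperator
  rw [Subtype.val_injective.extend_apply]
  rfl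

theorem extend_swap_eq_zero {k : Fin (n - 1)} {v : StandardTableau n μ → ℝ}
    {T : StandardTableau n μ}
    (h : ∀ S : StandardTableau n μ, S.1 = (adjacentSwap k).trans T.1 → v S = 0) :
    Function.extend Subtype.val v 0 ((adjacentSwap k).trans T.1) = 0 := by
  by_cases hS : ∃ S : StandardTableau n μ, S.1 = (adjacentSwap k).trans T.1
  · obtain ⟨S, hS⟩ := hS
    rw [← hS, Subtype.val_injective.extend_apply, h S hS]
  · exact Function.extend_apply' _ _ _ hS

/-- A vector fixed by the permutations of the entries `0, …, m - 1` is supported on tableaux with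
these entries in the first row. Otherwise let `k + 1` be the first offending entry of a tableau
`T` in the support: exchanging it with `k` leads out of the support, so `v T` is multiplied
by `1 / d`, where the axial distance `d` is negative. -/
theorem row_eq_zero_of_invariant {v : StandardTableau n μ → ℝ} {m : ℕ}
    (hv : ∀ k : Fin (n - 1), k.1 + 1 < m → (youngGenerator n μ k).mulVec v = v)
    {T : StandardTableau n μ} (hT : v T ≠ 0) {a : Fin n} (ha : a.1 < m) : (T.1 a).1.1 = 0 := by
  induction m generalizing T a with
  | zero => exact absurd ha (Nat.not_lt_zero _)
  | succ m ih =>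
    have ih' : ∀ {T : StandardTableau n μ}, v T ≠ 0 → ∀ {a : Fin n}, a.1 < m → (T.1 a).1.1 = 0 :=
      fun hT _ ha => ih (fun k hk => hv k (by omega)) hT ha
    rcases (Nat.lt_succ_iff.1 ha).lt_or_eq with ha' | ha'
    · exact ih' hT ha'
    by_contra hrow
    obtain ⟨b, hb⟩ := T.exists_entry (μ.up_left_mem (Nat.zero_le _) le_rfl (T.mem a))
    have hba : b < a :=
      T.2.2 b a (by rw [hb]) (by rw [hb]; exact Nat.pos_of_ne_zero hrow)
    have hm : 0 < m := by rw [← ha']; exact lt_of_le_of_lt (Nat.zero_le _) hba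
    let k : Fin (n - 1) := ⟨m - 1, by have := a.2; omega⟩
    have hlow : (lowerEntry k).1 = m - 1 := rfl
    have hup : upperEntry k = a := Fin.ext (by simp only [upperEntry, k]; omega)
    have hlrow : (T.1 (lowerEntry k)).1.1 = 0 := ih' hT (by omega)
    have hcol : (T.1 a).1.2 ≤ (T.1 (lowerEntry k)).1.2 := by
      by_contra! h
      have := T.2.1 (lowerEntry k) b (by rw [hb, hlrow]) (by rw [hb]; exact h)
      rw [Fin.lt_def] at this hba
      omega
    have hd : axialDistance T k < 0 := by
      unfold axialDistance tableauContent
      rw [hup, hlrow]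
      omega
    have h0 : Function.extend Subtype.val v 0 ((adjacentSwap k).trans T.1) = 0 := by
      refine extend_swap_eq_zero fun S hS => ?_
      by_contra hvS
      have := ih' hvS (a := lowerEntry k) (by omega)
      rw [hS, Equiv.trans_apply, adjacentSwap_lowerEntry, hup] at this
      exact hrow this
    have key := congrFun (hv k (by simp only [k]; omega)) T
    rw [youngGenerator_mulVec_apply, h0, mul_zero, add_zero] at key
    have hneg : ((axialDistance T k : ℝ))⁻¹ < 0 := inv_lt_zero.2 (by exact_mod_cast hd)
    have : ((axialDistance T k : ℝ)⁻¹ - 1) * v T = 0 := by linarith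
    rcases mul_eq_zero.1 this with h | h
    · linarith
    · exact hT h

/-- A tableau with the entries `0, …, n - 3` in the first row, `n - 1` below the first row and
`n - 2` in a row different from that of `n - 1`. -/
def IsTerminal (T : StandardTableau n μ) : Prop :=
  (∀ a : Fin n, a.1 + 2 < n → (T.1 a).1.1 = 0) ∧
    ∀ k : Fin (n - 1), k.1 + 2 = n →
      (T.1 (upperEntry k)).1.1 ≠ 0 ∧ (T.1 (lowerEntry k)).1.1 ≠ (T.1 (upperEntry k)).1.1

/-- Vectors that are fixed by the permutations of `0, …, n - 3` and negated by the transposition of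
`n - 2` and `n - 1`. -/
structure IsPairAlternating (v : StandardTableau n μ → ℝ) : Prop where
  invariant : ∀ k : Fin (n - 1), k.1 + 3 < n → (youngGenerator n μ k).mulVec v = v
  alternating : ∀ k : Fin (n - 1), k.1 + 2 = n → (youngGenerator n μ k).mulVec v = -v

/-- The value at a nonterminal tableau is forced to vanish by the last adjacent transposition, which
acts there by `1`, or by a positive number up to the value at a terminal tableau. -/
theorem IsPairAlternating.eq_zero {v : StandardTableau n μ → ℝ} (hv : IsPairAlternating v)
    {k : Fin (n - 1)} (hk : k.1 + 2 = n) (h : ∀ T, IsTerminal T → v T = 0) : v = 0 := by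
  funext T
  by_contra hT
  have hk_eq : ∀ l : Fin (n - 1), l.1 + 2 = n → l = k := fun l hl => Fin.ext (by omega)
  have hsupp : ∀ a : Fin n, a.1 + 2 < n → (T.1 a).1.1 = 0 := fun a ha =>
    row_eq_zero_of_invariant (m := n - 2) (fun l hl => hv.invariant l (by omega)) hT (by omega)
  have key := congrFun (hv.alternating k hk) T
  rw [youngGenerator_mulVec_apply, Pi.neg_apply] at key
  by_cases hrow : (T.1 (lowerEntry k)).1.1 = (T.1 (upperEntry k)).1.1
  · rw [T.axialDistance_of_row_eq hrow] at key
    simp only [Int.cast_one, inv_one, one_pow, sub_self, Real.sqrt_zero] at key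
    exact hT (show v T = 0 by linarith)
  by_cases hup : (T.1 (upperEntry k)).1.1 = 0
  · have hlow : 0 < (T.1 (lowerEntry k)).1.1 := by omega
    have h0 : Function.extend Subtype.val v 0 ((adjacentSwap k).trans T.1) = 0 := by
      refine extend_swap_eq_zero fun S hS => h S ⟨fun a ha => ?_, fun l hl => ?_⟩
      · rw [hS, Equiv.trans_apply, adjacentSwap_apply_of_ne (by omega) (by omega), hsupp a ha]
      · rw [hk_eq l hl, hS]
        simp only [Equiv.trans_apply, adjacentSwap_lowerEntry, adjacentSwap_upperEntry]
        omega
    obtain ⟨b, hb⟩ := T.exists_entry (μ.up_left_mem (Nat.zero_le _) le_rfl (T.mem (lowerEntry k)))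
    have hblow : b < lowerEntry k := T.2.2 b _ (by rw [hb]) (by rw [hb]; exact hlow)
    have hcol : (T.1 (lowerEntry k)).1.2 ≤ (T.1 (upperEntry k)).1.2 := by
      by_contra! h
      have := T.2.1 (upperEntry k) b (by rw [hb, hup]) (by rw [hb]; exact h)
      simp only [Fin.lt_def, lowerEntry, upperEntry] at this hblow
      omega
    have hd : 0 < axialDistance T k := by
      unfold axialDistance tableauContent
      omega
    have hpos : 0 < ((axialDistance T k : ℝ))⁻¹ := inv_pos.2 (by exact_mod_cast hd)
    rw [h0, mul_zero, add_zero] at key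
    have : ((axialDistance T k : ℝ)⁻¹ + 1) * v T = 0 := by linarith
    rcases mul_eq_zero.1 this with h | h
    · linarith
    · exact hT h
  · exact hT (h T ⟨hsupp, fun l hl => by rw [hk_eq l hl]; exact ⟨hup, hrow⟩⟩)

/-- Families of vectors indexed by ordered pairs of entries that depend on the pair alternatingly
and on which Young's representation acts by permuting the pairs. -/
structure IsAlternatingFamily (r : Fin n → Fin n → StandardTableau n μ → ℝ) : Prop where
  equivariant : ∀ k i j,
    (youngGenerator n μ k).mulVec (r i j) = r (adjacentSwap k i) (adjacentSwap k j)
  alternating : ∀ i j, r j i = -r i j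

namespace IsAlternatingFamily

variable {r q : Fin n → Fin n → StandardTableau n μ → ℝ}

theorem isPairAlternating (hr : IsAlternatingFamily r) {k : Fin (n - 1)} (hk : k.1 + 2 = n) :
    IsPairAlternating (r (upperEntry k) (lowerEntry k)) where
  invariant l hl := by
    rw [hr.equivariant, adjacentSwap_apply_of_ne, adjacentSwap_apply_of_ne] <;>
      simp only [upperEntry, lowerEntry] <;> omega
  alternating l hl := by
    obtain rfl : l = k := Fin.ext (by omega)
    rw [hr.equivariant, adjacentSwap_lowerEntry, adjacentSwap_upperEntry, hr.alternating]

/-- The symmetric group is transitive on ordered pairs of distinct entries. -/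
theorem eq_zero (hr : IsAlternatingFamily r) {x y : Fin n} (hxy : x ≠ y) (h : r x y = 0)
    (i j : Fin n) : r i j = 0 := by
  by_cases hij : i = j
  · subst hij
    funext T
    have := congrFun (hr.alternating i i) T
    rw [Pi.neg_apply] at this
    rw [Pi.zero_apply]
    linarith
  have hw : ∀ w : List (Fin (n - 1)),
      r ((w.map adjacentSwap).prod x) ((w.map adjacentSwap).prod y) = 0 := by
    intro w
    induction w with
    | nil => exact h
    | cons k w ih =>
      rw [List.map_cons, List.prod_cons, Equiv.Perm.mul_apply, Equiv.Perm.mul_apply,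
        ← hr.equivariant, ih, Matrix.mulVec_zero]
  -- a permutation that maps `x` to `i` and `y` to `j`
  let σ : Equiv.Perm (Fin n) := Equiv.swap (Equiv.swap x i y) j * Equiv.swap x i
  have hx : σ x = i := by
    simp only [σ, Equiv.Perm.mul_apply, Equiv.swap_apply_left]
    refine Equiv.swap_apply_of_ne_of_ne (fun e => hxy ?_) hij
    rw [← (Equiv.swap x i).injective.eq_iff, ← e, Equiv.swap_apply_left]
  have hy : σ y = j := by simp only [σ, Equiv.Perm.mul_apply, Equiv.swap_apply_left]
  obtain ⟨w, hσ⟩ := exists_adjacentSwap_word σ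
  have := hw w
  rwa [hσ, hx, hy] at this

theorem eq_zero_of_terminal (hr : IsAlternatingFamily r) {k : Fin (n - 1)} (hk : k.1 + 2 = n)
    (h : ∀ T, IsTerminal T → r (upperEntry k) (lowerEntry k) T = 0) (i j : Fin n) : r i j = 0 :=
  hr.eq_zero (lowerEntry_ne_upperEntry k).symm ((hr.isPairAlternating hk).eq_zero hk h) i j

theorem linear_combination (hr : IsAlternatingFamily r) (hq : IsAlternatingFamily q) (α β : ℝ) :
    IsAlternatingFamily fun i j => α • r i j - β • q i j where
  equivariant k i j := by
    rw [Matrix.mulVec_sub, Matrix.mulVec_smul, Matrix.mulVec_smul, hr.equivariant, hq.equivariant]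
  alternating i j := by
    rw [hr.alternating i j, hq.alternating i j, smul_neg, smul_neg, neg_sub, neg_sub_neg]

/-- When there is at most one terminal tableau, any two alternating families are proportional. -/
theorem proportional (hr : IsAlternatingFamily r) (hq : IsAlternatingFamily q) {k : Fin (n - 1)}
    (hk : k.1 + 2 = n) {T₀ : StandardTableau n μ} (hT₀ : ∀ T, IsTerminal T → T = T₀) (i j : Fin n) :
    q (upperEntry k) (lowerEntry k) T₀ • r i j = r (upperEntry k) (lowerEntry k) T₀ • q i j := by
  refine sub_eq_zero.1 ((hr.linear_combination hq _ _).eq_zero_of_terminal hk (fun T hT => ?_) i j)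
  rw [hT₀ T hT, Pi.sub_apply, Pi.smul_apply, Pi.smul_apply, smul_eq_mul, smul_eq_mul, mul_comm,
    sub_self]

end IsAlternatingFamily

end Invariants

/-! ### Pair sums of Young's matrices -/

section PairSums

variable {n : ℕ} {μ : YoungDiagram}

/-- The contribution of the positions `i` and `j` to the Fourier coefficient of the objective. -/
noncomputable def pairCoefficient (μ : YoungDiagram) (A : Matrix (Fin n) (Fin n) ℝ) (i j : Fin n) :
    Matrix (StandardTableau n μ) (StandardTableau n μ) ℝ :=
  ∑ σ : Equiv.Perm (Fin n), A (σ i) (σ j) • youngOrthogonalRep n μ σ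

theorem pairCoefficient_mul_youngGenerator (A : Matrix (Fin n) (Fin n) ℝ) (i j : Fin n)
    (k : Fin (n - 1)) :
    pairCoefficient μ A i j * youngGenerator n μ k =
      pairCoefficient μ A (adjacentSwap k i) (adjacentSwap k j) := by
  unfold pairCoefficient
  rw [Finset.sum_mul]
  refine Fintype.sum_equiv (Equiv.mulRight (adjacentSwap k)) _ _ fun σ => ?_
  rw [Equiv.coe_mulRight, youngOrthogonalRep_mul_adjacentSwap, Matrix.smul_mul,
    Equiv.Perm.mul_apply, Equiv.Perm.mul_apply, adjacentSwap_adjacentSwap,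
    adjacentSwap_adjacentSwap]

theorem youngGenerator_mulVec_row (M : Matrix (StandardTableau n μ) (StandardTableau n μ) ℝ)
    (R : StandardTableau n μ) (k : Fin (n - 1)) :
    (youngGenerator n μ k).mulVec (M R) = (M * youngGenerator n μ k) R := by
  rw [← vecMul_youngGenerator]
  rfl

theorem isAlternatingFamily_pairCoefficient (A : Matrix (Fin n) (Fin n) ℝ)
    (R : StandardTableau n μ) :
    IsAlternatingFamily fun i j => (pairCoefficient μ A i j - pairCoefficient μ A j i) R where
  equivariant k i j := by
    rw [youngGenerator_mulVec_row, sub_mul, pairCoefficient_mul_youngGenerator,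
      pairCoefficient_mul_youngGenerator]
  alternating i j := by
    rw [← neg_sub]
    rfl

theorem fourierCoefficient_lopObjective (A : Matrix (Fin n) (Fin n) ℝ) :
    fourierCoefficient (lopObjective A) μ =
      ∑ j : Fin n, ∑ i ∈ Finset.Ioi j, pairCoefficient μ A i j := by
  unfold fourierCoefficient lopObjective pairCoefficient
  simp only [Finset.sum_smul]
  rw [Finset.sum_comm]
  exact Finset.sum_congr rfl fun j _ => Finset.sum_comm

theorem eq_zero_of_mul_youngGenerator
    {M : Matrix (StandardTableau n μ) (StandardTableau n μ) ℝ}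
    (hM : ∀ k, M * youngGenerator n μ k = M)
    (hμ : ∀ T : StandardTableau n μ, ∃ a, (T.1 a).1.1 ≠ 0) : M = 0 := by
  ext R T
  by_contra h
  obtain ⟨a, ha⟩ := hμ T
  exact ha (row_eq_zero_of_invariant (m := n) (v := M R)
    (fun k _ => by rw [youngGenerator_mulVec_row, hM]) h a.2)

/-- The symmetric part of the objective is constant, so away from the trivial representation only
the antisymmetric part contributes. -/
theorem two_smul_fourierCoefficient (A : Matrix (Fin n) (Fin n) ℝ)
    (hμ : ∀ T : StandardTableau n μ, ∃ a, (T.1 a).1.1 ≠ 0) :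
    (2 : ℝ) • fourierCoefficient (lopObjective A) μ =
      ∑ j : Fin n, ∑ i ∈ Finset.Ioi j, (pairCoefficient μ A i j - pairCoefficient μ A j i) := by
  have htot : ∑ j : Fin n, ∑ i : Fin n, pairCoefficient μ A i j = 0 := by
    refine eq_zero_of_mul_youngGenerator (fun k => ?_) hμ
    simp only [Finset.sum_mul, pairCoefficient_mul_youngGenerator]
    rw [Equiv.sum_comp (adjacentSwap k) fun j =>
      ∑ i : Fin n, pairCoefficient μ A (adjacentSwap k i) j]
    exact Finset.sum_congr rfl fun j _ =>
      Equiv.sum_comp (adjacentSwap k) fun i => pairCoefficient μ A i j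
  have hdiag : ∑ j : Fin n, pairCoefficient μ A j j = 0 := by
    refine eq_zero_of_mul_youngGenerator (fun k => ?_) hμ
    simp only [Finset.sum_mul, pairCoefficient_mul_youngGenerator]
    exact Equiv.sum_comp (adjacentSwap k) fun j => pairCoefficient μ A j j
  have hsplit : ∀ j : Fin n, ∑ i : Fin n, pairCoefficient μ A i j =
      ∑ i ∈ Finset.Iio j, pairCoefficient μ A i j +
        (pairCoefficient μ A j j + ∑ i ∈ Finset.Ioi j, pairCoefficient μ A i j) := by
    intro j
    have hu : (Finset.univ : Finset (Fin n)) = Finset.Iio j ∪ ({j} ∪ Finset.Ioi j) := by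
      ext i
      simp only [Finset.mem_univ, Finset.mem_union, Finset.mem_Iio, Finset.mem_singleton,
        Finset.mem_Ioi, true_iff]
      exact lt_trichotomy i j
    rw [hu, Finset.sum_union, Finset.sum_union, Finset.sum_singleton]
    · simp
    · rw [Finset.disjoint_left]
      intro i hi hi'
      simp only [Finset.mem_union, Finset.mem_Iio, Finset.mem_singleton,
        Finset.mem_Ioi] at hi hi'
      rcases hi' with rfl | hi'
      · exact lt_irrefl _ hi
      · exact lt_asymm hi hi'
  have hswap : ∑ j : Fin n, ∑ i ∈ Finset.Iio j, pairCoefficient μ A i j =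
      ∑ j : Fin n, ∑ i ∈ Finset.Ioi j, pairCoefficient μ A j i :=
    Finset.sum_comm' fun x y => by simp
  simp only [hsplit, Finset.sum_add_distrib, hdiag, zero_add, hswap] at htot
  simp only [fourierCoefficient_lopObjective, Finset.sum_sub_distrib]
  rw [eq_neg_of_add_eq_zero_left htot, sub_neg_eq_add, two_smul]

end PairSums

/-! ### Shapes that admit a terminal tableau -/

section Shapes

variable {n : ℕ} {μ : YoungDiagram}

theorem colLen_zero_eq {m : ℕ} (h : (m, 0) ∈ μ) (h' : (m + 1, 0) ∉ μ) : μ.colLen 0 = m + 1 := by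
  rw [YoungDiagram.mem_iff_lt_colLen] at h h'
  omega

theorem rowLens_eq_of_row_eq_zero (hn : 0 < n) (T : StandardTableau n μ)
    (hT : ∀ a, (T.1 a).1.1 = 0) : μ.rowLens = [n] := by
  have h0 : (0, 0) ∈ μ := μ.up_left_mem (Nat.zero_le _) (Nat.zero_le _) (T.mem ⟨0, hn⟩)
  have h1 : (1, 0) ∉ μ := fun h => by
    obtain ⟨x, hx⟩ := T.exists_entry h
    have := hT x
    rw [hx] at this
    exact one_ne_zero this
  have hr : μ.rowLen 0 = n := by
    rw [T.rowLen_eq_card, Finset.filter_true_of_mem fun a _ => hT a, Finset.card_univ,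
      Fintype.card_fin]
  unfold YoungDiagram.rowLens
  rw [colLen_zero_eq h0 h1]
  simp [hr]

theorem IsTerminal.rowLens_eq {T : StandardTableau n μ} (hT : IsTerminal T) {k : Fin (n - 1)}
    (hk : k.1 + 2 = n) : μ.rowLens = [n - 1, 1] ∨ μ.rowLens = [n - 2, 1, 1] := by
  obtain ⟨hup, hne⟩ := hT.2 k hk
  have hfirst : ∀ a, a ≠ lowerEntry k → a ≠ upperEntry k → (T.1 a).1.1 = 0 := fun a h h' => by
    refine hT.1 a ?_
    have h1 : a.1 ≠ k.1 := fun e => h (Fin.ext e)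
    have h2 : a.1 ≠ k.1 + 1 := fun e => h' (Fin.ext e)
    omega
  obtain ⟨x, hx⟩ := T.exists_entry (i := 1) (j := 0)
    (μ.up_left_mem (Nat.pos_of_ne_zero hup) (Nat.zero_le _) (T.mem (upperEntry k)))
  have hx0 : (T.1 x).1.1 = 1 := by rw [hx]
  by_cases hlow : (T.1 (lowerEntry k)).1.1 = 0
  · left
    have hall : ∀ a, a ≠ upperEntry k → (T.1 a).1.1 = 0 := fun a h => by
      by_cases h' : a = lowerEntry k
      · rw [h', hlow]
      · exact hfirst a h' h
    have hxup : x = upperEntry k := by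
      by_contra h
      have := hall x h
      omega
    have h2 : (2, 0) ∉ μ := fun h => by
      obtain ⟨y, hy⟩ := T.exists_entry h
      have hy0 : (T.1 y).1.1 = 2 := by rw [hy]
      by_cases hyu : y = upperEntry k
      · rw [hyu, ← hxup] at hy0
        omega
      · have := hall y hyu
        omega
    have hr0 : μ.rowLen 0 = n - 1 := by
      rw [T.rowLen_eq_card, show (Finset.univ.filter fun a => (T.1 a).1.1 = 0) =
        Finset.univ.erase (upperEntry k) by
          ext a
          simp only [Finset.mem_filter, Finset.mem_univ, true_and, Finset.mem_erase, and_true]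
          exact ⟨fun h e => hup (e ▸ h), hall a⟩,
        Finset.card_erase_of_mem (Finset.mem_univ _), Finset.card_univ, Fintype.card_fin]
    have hr1 : μ.rowLen 1 = 1 := by
      rw [T.rowLen_eq_card, Finset.card_eq_one]
      refine ⟨x, ?_⟩
      ext a
      simp only [Finset.mem_filter, Finset.mem_univ, true_and, Finset.mem_singleton]
      refine ⟨fun h => ?_, fun h => by rw [h, hx0]⟩
      by_contra hax
      have := hall a (hxup ▸ hax)
      omega
    unfold YoungDiagram.rowLens
    rw [colLen_zero_eq (m := 1) (hx ▸ T.mem x) h2]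
    simp [List.range_succ, hr0, hr1]
  · right
    have h2 : (2, 0) ∈ μ := by
      rcases Nat.lt_or_ge (T.1 (upperEntry k)).1.1 2 with h | h
      · exact μ.up_left_mem (show 2 ≤ (T.1 (lowerEntry k)).1.1 by omega) (Nat.zero_le _)
          (T.mem (lowerEntry k))
      · exact μ.up_left_mem h (Nat.zero_le _) (T.mem (upperEntry k))
    obtain ⟨y, hy⟩ := T.exists_entry h2
    have hy0 : (T.1 y).1.1 = 2 := by rw [hy]
    have hxy : x < y := T.2.2 x y (by rw [hx, hy]) (by rw [hx, hy]; exact Nat.one_lt_two)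
    have hxcases : x = lowerEntry k ∨ x = upperEntry k := by
      by_contra! h
      have := hfirst x h.1 h.2
      omega
    have hycases : y = lowerEntry k ∨ y = upperEntry k := by
      by_contra! h
      have := hfirst y h.1 h.2
      omega
    have hlt : lowerEntry k < upperEntry k := Nat.lt_succ_self k.1
    obtain ⟨rfl, rfl⟩ : x = lowerEntry k ∧ y = upperEntry k := by
      rcases hxcases with rfl | rfl <;> rcases hycases with rfl | rfl
      · exact absurd hxy (lt_irrefl _)
      · exact ⟨rfl, rfl⟩
      · exact absurd hxy (lt_asymm hlt)
      · exact absurd hxy (lt_irrefl _)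
    have h3 : (3, 0) ∉ μ := fun h => by
      obtain ⟨z, hz⟩ := T.exists_entry h
      have hz0 : (T.1 z).1.1 = 3 := by rw [hz]
      by_cases hzl : z = lowerEntry k
      · rw [hzl] at hz0
        omega
      by_cases hzu : z = upperEntry k
      · rw [hzu] at hz0
        omega
      have := hfirst z hzl hzu
      omega
    have hr0 : μ.rowLen 0 = n - 2 := by
      rw [T.rowLen_eq_card, show (Finset.univ.filter fun a => (T.1 a).1.1 = 0) =
        (Finset.univ.erase (upperEntry k)).erase (lowerEntry k) by
          ext a
          simp only [Finset.mem_filter, Finset.mem_univ, true_and, Finset.mem_erase, and_true]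
          exact ⟨fun h => ⟨fun e => hlow (e ▸ h), fun e => hup (e ▸ h)⟩,
            fun h => hfirst a h.1 h.2⟩,
        Finset.card_erase_of_mem (Finset.mem_erase.2 ⟨hlt.ne, Finset.mem_univ _⟩),
        Finset.card_erase_of_mem (Finset.mem_univ _), Finset.card_univ, Fintype.card_fin]
      omega
    have hr1 : μ.rowLen 1 = 1 := by
      rw [T.rowLen_eq_card, Finset.card_eq_one]
      refine ⟨lowerEntry k, ?_⟩
      ext a
      simp only [Finset.mem_filter, Finset.mem_univ, true_and, Finset.mem_singleton]
      refine ⟨fun h => ?_, fun h => by rw [h, hx0]⟩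
      by_contra hal
      by_cases hau : a = upperEntry k
      · rw [hau] at h
        omega
      · have := hfirst a hal hau
        omega
    have hr2 : μ.rowLen 2 = 1 := by
      rw [T.rowLen_eq_card, Finset.card_eq_one]
      refine ⟨upperEntry k, ?_⟩
      ext a
      simp only [Finset.mem_filter, Finset.mem_univ, true_and, Finset.mem_singleton]
      refine ⟨fun h => ?_, fun h => by rw [h, hy0]⟩
      by_contra hau
      by_cases hal : a = lowerEntry k
      · rw [hal] at h
        omega
      · have := hfirst a hal hau
        omega
    unfold YoungDiagram.rowLens
    rw [colLen_zero_eq h2 h3]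
    simp [List.range_succ, hr0, hr1, hr2]

/-- The Fourier coefficient vanishes at every shape without a terminal tableau, since the rows of
the pair coefficients are alternating families. -/
theorem fourierCoefficient_eq_zero (A : Matrix (Fin n) (Fin n) ℝ)
    (h1 : μ.rowLens ≠ [n]) (h2 : μ.rowLens ≠ [n - 1, 1]) (h3 : μ.rowLens ≠ [n - 2, 1, 1]) :
    fourierCoefficient (lopObjective A) μ = 0 := by
  rcases Nat.eq_zero_or_pos n with rfl | hn
  · simp [fourierCoefficient, lopObjective]
  have hμ : ∀ T : StandardTableau n μ, ∃ a, (T.1 a).1.1 ≠ 0 := fun T => by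
    by_contra! h
    exact h1 (rowLens_eq_of_row_eq_zero hn T h)
  suffices h : (2 : ℝ) • fourierCoefficient (lopObjective A) μ = 0 from
    (smul_eq_zero.1 h).resolve_left two_ne_zero
  rw [two_smul_fourierCoefficient A hμ]
  refine Finset.sum_eq_zero fun j _ => Finset.sum_eq_zero fun i hi => ?_
  have hij : j < i := Finset.mem_Ioi.1 hi
  rw [Fin.lt_def] at hij
  let k : Fin (n - 1) := ⟨n - 2, by have := i.2; omega⟩
  have hk : k.1 + 2 = n := by
    have := i.2
    simp only [k]
    omega
  ext R T
  exact congrFun ((isAlternatingFamily_pairCoefficient A R).eq_zero_of_terminal hk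
    (fun S hS => ((hS.rowLens_eq hk).elim h2 h3).elim) i j) T

end Shapes

/-! ### Gelfand–Tsetlin coordinates of the standard representation -/

/-- The `i`-th entry of `(1, …, 1, -k, 0, …)`, with `k` ones. For `0 < k < n` these vectors form the
orthogonal Gelfand–Tsetlin basis of the standard representation on the first `n` coordinates. -/
def gelfandTsetlin (k i : ℕ) : ℝ := if i < k then 1 else if i = k then -k else 0

/-- The inverse length of the `k`-th Gelfand–Tsetlin vector. -/
noncomputable def gelfandTsetlinScale (k : ℕ) : ℝ := (Real.sqrt k * Real.sqrt (k + 1))⁻¹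

/-- The normalised Gelfand–Tsetlin vectors. -/
noncomputable def unitGelfandTsetlin (k i : ℕ) : ℝ := gelfandTsetlinScale k * gelfandTsetlin k i

theorem gelfandTsetlinScale_ne_zero {k : ℕ} (hk : 0 < k) : gelfandTsetlinScale k ≠ 0 := by
  unfold gelfandTsetlinScale
  have : (0 : ℝ) < k := by exact_mod_cast hk
  positivity

theorem natAdjacentSwap_apply (m i : ℕ) :
    natAdjacentSwap m i = if i = m then m + 1 else if i = m + 1 then m else i :=
  Equiv.swap_apply_def _ _ _

theorem unitGelfandTsetlin_swap_of_ne {m k : ℕ} (h : k ≠ m) (h' : k ≠ m + 1) (i : ℕ) :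
    unitGelfandTsetlin k (natAdjacentSwap m i) = unitGelfandTsetlin k i := by
  unfold unitGelfandTsetlin gelfandTsetlin
  rw [natAdjacentSwap_apply]
  congr 1
  split_ifs <;> first | rfl | omega

theorem sqrt_one_sub_inv_sq_eq (m : ℕ) :
    Real.sqrt (1 - (((m : ℝ) + 1)⁻¹) ^ 2) = Real.sqrt m * Real.sqrt (m + 2) / (m + 1) := by
  have hm : (0 : ℝ) < (m : ℝ) + 1 := by positivity
  rw [← Real.sqrt_mul (Nat.cast_nonneg m), ← Real.sqrt_sq hm.le, ← Real.sqrt_div (by positivity),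
    Real.sqrt_sq hm.le]
  congr 1
  field_simp
  ring

theorem sqrt_mul_scale {m : ℕ} (hm : 0 < m) :
    Real.sqrt (1 - (((m : ℝ) + 1)⁻¹) ^ 2) * gelfandTsetlinScale m =
      (m + 2) / (m + 1) * gelfandTsetlinScale (m + 1) := by
  have h0 : (0 : ℝ) < m := by exact_mod_cast hm
  rw [sqrt_one_sub_inv_sq_eq]
  unfold gelfandTsetlinScale
  push_cast
  rw [show (m : ℝ) + 1 + 1 = m + 2 by ring]
  have h2 : Real.sqrt ((m : ℝ) + 2) ^ 2 = m + 2 := Real.sq_sqrt (by positivity)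
  field_simp
  linear_combination h2

theorem sqrt_mul_scale_succ (m : ℕ) :
    Real.sqrt (1 - (((m : ℝ) + 1)⁻¹) ^ 2) * gelfandTsetlinScale (m + 1) =
      m / (m + 1) * gelfandTsetlinScale m := by
  rcases Nat.eq_zero_or_pos m with rfl | hm
  · simp
  have h0 : (0 : ℝ) < m := by exact_mod_cast hm
  rw [sqrt_one_sub_inv_sq_eq]
  unfold gelfandTsetlinScale
  push_cast
  rw [show (m : ℝ) + 1 + 1 = m + 2 by ring]
  have h2 : Real.sqrt (m : ℝ) ^ 2 = m := Real.sq_sqrt (by positivity)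
  field_simp
  linear_combination h2

/-- Young's formula in the standard representation, where `k = m + 1` has axial distance
`-(m + 1)`. At `m = 0` the vector with index `m` is zero by convention. -/
theorem unitGelfandTsetlin_swap_succ (m i : ℕ) :
    unitGelfandTsetlin (m + 1) (natAdjacentSwap m i) =
      -((m : ℝ) + 1)⁻¹ * unitGelfandTsetlin (m + 1) i +
        Real.sqrt (1 - (((m : ℝ) + 1)⁻¹) ^ 2) * unitGelfandTsetlin m i := by
  have hm1 : (m : ℝ) + 1 ≠ 0 := by positivity
  unfold unitGelfandTsetlin
  rw [← mul_assoc (Real.sqrt _)]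
  rcases Nat.eq_zero_or_pos m with rfl | hm
  · unfold gelfandTsetlin
    rw [natAdjacentSwap_apply]
    split_ifs <;> first | omega | simp
  rw [sqrt_mul_scale hm]
  unfold gelfandTsetlin
  rw [natAdjacentSwap_apply]
  split_ifs <;> first | omega | (push_cast; field_simp; try ring)

theorem unitGelfandTsetlin_swap_self (m i : ℕ) :
    unitGelfandTsetlin m (natAdjacentSwap m i) =
      ((m : ℝ) + 1)⁻¹ * unitGelfandTsetlin m i +
        Real.sqrt (1 - (((m : ℝ) + 1)⁻¹) ^ 2) * unitGelfandTsetlin (m + 1) i := by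
  have hm1 : (m : ℝ) + 1 ≠ 0 := by positivity
  unfold unitGelfandTsetlin
  rw [← mul_assoc (Real.sqrt _), sqrt_mul_scale_succ]
  unfold gelfandTsetlin
  rw [natAdjacentSwap_apply]
  split_ifs <;> first | omega | (push_cast; field_simp; try ring)

/-- The `(i, j)` coordinate of the wedge of the `k`-th and `l`-th normalised Gelfand–Tsetlin
vectors. If `n ≤ l`, the latter is constant on the first `n` coordinates, and the wedge is the
coordinate difference of the `k`-th vector, up to a factor. -/
noncomputable def wedgeCoordinate (k l i j : ℕ) : ℝ :=
  unitGelfandTsetlin k i * unitGelfandTsetlin l j - unitGelfandTsetlin k j * unitGelfandTsetlin l i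

/-- The content of `a` in the standard tableau of hook shape with `k`, `l` below the first row. -/
def hookContent (k l a : ℕ) : ℤ :=
  if a = k then -1 else if a = l then -2
  else a - (if k < a then 1 else 0) - (if l < a then 1 else 0)

/-- Young's formula for the action of an adjacent transposition on a wedge. The exchanged legs
`m + 1`, `m` may be out of order; the distance is then `-1` and the off-diagonal term vanishes. -/
theorem wedgeCoordinate_swap {k l m : ℕ} (hkl : k < l) {d : ℤ}
    (hd : d = hookContent k l (m + 1) - hookContent k l m) (i j : ℕ) :
    (d : ℝ)⁻¹ * wedgeCoordinate k l i j + Real.sqrt (1 - ((d : ℝ)⁻¹) ^ 2) *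
        wedgeCoordinate (natAdjacentSwap m k) (natAdjacentSwap m l) i j =
      wedgeCoordinate k l (natAdjacentSwap m i) (natAdjacentSwap m j) := by
  have hneg : ∀ x : ℝ, (-x)⁻¹ = -x⁻¹ := fun x => inv_neg
  unfold wedgeCoordinate
  by_cases h1 : k = m
  · subst h1
    by_cases h2 : l = k + 1
    · subst h2
      have : d = -1 := by
        rw [hd]
        simp [hookContent]
      subst this
      rw [unitGelfandTsetlin_swap_self, unitGelfandTsetlin_swap_self, unitGelfandTsetlin_swap_succ,
        unitGelfandTsetlin_swap_succ]
      have hsq := sq_sqrt_one_sub_inv_sq (d := (k : ℤ) + 1) (by omega)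
      push_cast at hsq ⊢
      rw [show (1 : ℝ) - ((-1)⁻¹) ^ 2 = 0 by norm_num, Real.sqrt_zero]
      linear_combination (unitGelfandTsetlin k i * unitGelfandTsetlin (k + 1) j -
        unitGelfandTsetlin k j * unitGelfandTsetlin (k + 1) i) * hsq
    · have : d = k + 1 := by
        rw [hd]
        unfold hookContent
        split_ifs <;> omega
      subst this
      rw [unitGelfandTsetlin_swap_self, unitGelfandTsetlin_swap_self,
        unitGelfandTsetlin_swap_of_ne (by omega) (by omega),
        unitGelfandTsetlin_swap_of_ne (by omega) (by omega),
        natAdjacentSwap_apply, natAdjacentSwap_apply, if_pos rfl, if_neg (by omega),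
        if_neg (by omega)]
      push_cast
      ring
  by_cases h2 : k = m + 1
  · subst h2
    have : d = -(m + 1) := by
      rw [hd]
      unfold hookContent
      split_ifs <;> omega
    subst this
    rw [unitGelfandTsetlin_swap_succ, unitGelfandTsetlin_swap_succ,
      unitGelfandTsetlin_swap_of_ne (by omega) (by omega),
      unitGelfandTsetlin_swap_of_ne (by omega) (by omega),
      natAdjacentSwap_apply, natAdjacentSwap_apply, if_neg (by omega), if_pos rfl,
      if_neg (by omega), if_neg (by omega)]
    push_cast
    rw [hneg, neg_sq]
    ring
  rw [unitGelfandTsetlin_swap_of_ne h1 h2, unitGelfandTsetlin_swap_of_ne h1 h2,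
    natAdjacentSwap_apply m k, if_neg h1, if_neg h2]
  by_cases h3 : l = m
  · subst h3
    have : d = l + 1 := by
      rw [hd]
      unfold hookContent
      split_ifs <;> omega
    subst this
    rw [unitGelfandTsetlin_swap_self, unitGelfandTsetlin_swap_self, natAdjacentSwap_apply,
      if_pos rfl]
    push_cast
    ring
  by_cases h4 : l = m + 1
  · subst h4
    have : d = -(m + 1) := by
      rw [hd]
      unfold hookContent
      split_ifs <;> omega
    subst this
    rw [unitGelfandTsetlin_swap_succ, unitGelfandTsetlin_swap_succ, natAdjacentSwap_apply,
      if_neg (by omega), if_pos rfl]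
    push_cast
    rw [hneg, neg_sq]
    ring
  · have : d = 1 := by
      rw [hd]
      unfold hookContent
      split_ifs <;> omega
    subst this
    rw [unitGelfandTsetlin_swap_of_ne h3 h4, unitGelfandTsetlin_swap_of_ne h3 h4]
    simp

theorem sum_range_gelfandTsetlin (k n : ℕ) :
    ∑ i ∈ Finset.range n, gelfandTsetlin k i = if n ≤ k then (n : ℝ) else 0 := by
  induction n with
  | zero => simp
  | succ n ih =>
    rw [Finset.sum_range_succ, ih]
    unfold gelfandTsetlin
    rcases lt_trichotomy n k with h | h | h
    · rw [if_pos h.le, if_pos h, if_pos (by omega)]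
      push_cast
      ring
    · subst h
      simp
    · rw [if_neg (by omega), if_neg (by omega), if_neg (by omega), if_neg (by omega), add_zero]

/-- In the outer sum only the index `k` contributes. -/
theorem sum_range_wedgeCoordinate {k l n : ℕ} (hkl : k < l) :
    ∑ i ∈ Finset.range n, ∑ j ∈ Finset.range i, wedgeCoordinate k l i j =
      if k < n then -(gelfandTsetlinScale k * gelfandTsetlinScale l * (k * (k + 1))) else 0 := by
  have hin : ∀ i, ∑ j ∈ Finset.range i, wedgeCoordinate k l i j =
      gelfandTsetlinScale k * gelfandTsetlinScale l *
        (gelfandTsetlin k i * (if i ≤ l then (i : ℝ) else 0) -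
          (if i ≤ k then (i : ℝ) else 0) * gelfandTsetlin l i) := by
    intro i
    rw [← sum_range_gelfandTsetlin, ← sum_range_gelfandTsetlin, Finset.mul_sum, Finset.sum_mul,
      ← Finset.sum_sub_distrib, Finset.mul_sum]
    refine Finset.sum_congr rfl fun j _ => ?_
    unfold wedgeCoordinate unitGelfandTsetlin
    ring
  induction n with
  | zero => simp
  | succ n ih =>
    rw [Finset.sum_range_succ, ih, hin]
    unfold gelfandTsetlin
    rcases lt_trichotomy n k with h | h | h
    · rw [if_neg (by omega), if_pos h, if_pos (by omega), if_pos (by omega), if_pos (by omega),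
        if_neg (by omega)]
      ring
    · subst h
      rw [if_neg (by omega), if_neg (by omega), if_pos rfl, if_pos (by omega), if_pos (by omega),
        if_pos (by omega), if_pos (by omega)]
      ring
    · simp only [h, h.ne', not_lt.2 h.le, not_le.2 h, Nat.lt_succ_of_lt h, if_true, if_false]
      ring

theorem sum_fin_Ioi_eq_sum_range {n : ℕ} (f : ℕ → ℕ → ℝ) :
    ∑ j : Fin n, ∑ i ∈ Finset.Ioi j, f i j = ∑ i ∈ Finset.range n, ∑ j ∈ Finset.range i, f i j := by
  rw [← Fin.sum_univ_eq_sum_range fun i => ∑ j ∈ Finset.range i, f i j]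
  rw [Finset.sum_comm' (t' := Finset.univ) (s' := fun i => Finset.Iio i) fun x y => by simp]
  refine Finset.sum_congr rfl fun i _ => ?_
  rw [← Nat.Iio_eq_range, ← Fin.map_valEmbedding_Iio, Finset.sum_map]
  rfl

/-! ### The shapes `(n - 1, 1)` and `(n - 2, 1, 1)` -/

section ShortHooks

variable {n : ℕ} {μ : YoungDiagram}

/-- Hooks with one or two cells below the first row. -/
structure IsShortHook (μ : YoungDiagram) : Prop where
  leg : (1, 0) ∈ μ
  cells : ∀ i j, (i, j) ∈ μ → i ≠ 0 → j = 0 ∧ i ≤ 2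

theorem isShortHook_of_rowLens {p : ℕ} (h : μ.rowLens = [p, 1] ∨ μ.rowLens = [p, 1, 1]) :
    IsShortHook μ := by
  have hlen : μ.colLen 0 = 2 ∨ μ.colLen 0 = 3 := by
    rw [← YoungDiagram.length_rowLens]
    rcases h with h | h <;> simp [h]
  have hmem : ∀ i, i ≠ 0 → i < μ.colLen 0 → μ.rowLen i = 1 := by
    intro i hi hlt
    rw [← YoungDiagram.length_rowLens] at hlt
    rw [← YoungDiagram.get_rowLens (h := hlt)]
    rcases h with h | h
    · simp only [h, List.length_cons, List.length_nil] at hlt ⊢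
      obtain rfl : i = 1 := by omega
      rfl
    · simp only [h, List.length_cons, List.length_nil] at hlt ⊢
      obtain rfl | rfl : i = 1 ∨ i = 2 := by omega
      · rfl
      · rfl
  refine ⟨YoungDiagram.mem_iff_lt_colLen.2 (by omega), fun i j hij hi => ?_⟩
  have hcol : i < μ.colLen 0 :=
    YoungDiagram.mem_iff_lt_colLen.1 (μ.up_left_mem le_rfl (Nat.zero_le _) hij)
  have hrow := YoungDiagram.mem_iff_lt_rowLen.1 hij
  rw [hmem i hi hcol] at hrow
  omega

/-- The entry in row `r` of the first column; by convention `n` if there is no such cell. -/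
def legEntry (T : Fin n ≃ μ.cells) (r : ℕ) : ℕ :=
  if h : (r, 0) ∈ μ.cells then (T.symm ⟨(r, 0), h⟩).1 else n

theorem legEntry_trans (k : Fin (n - 1)) (T : Fin n ≃ μ.cells) (r : ℕ) :
    legEntry ((adjacentSwap k).trans T) r = natAdjacentSwap k.1 (legEntry T r) := by
  unfold legEntry
  rw [natAdjacentSwap_apply]
  by_cases h : (r, 0) ∈ μ.cells
  · rw [dif_pos h, dif_pos h, ← adjacentSwap_apply_val]
    rfl
  · have := k.2
    rw [dif_neg h, dif_neg h, if_neg (by omega), if_neg (by omega)]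

/-- The wedge of the coordinate vectors at `i` and `j`, in coordinates with respect to the
Gelfand–Tsetlin basis. For one cell below the first row it encodes a multiple of the difference of
these coordinate vectors. -/
noncomputable def hookPairVector (μ : YoungDiagram) (i j : Fin n) : StandardTableau n μ → ℝ :=
  fun T => wedgeCoordinate (legEntry T.1 1) (legEntry T.1 2) i.1 j.1

namespace IsShortHook

variable (hμ : IsShortHook μ) (T : StandardTableau n μ)

include hμ

theorem row_eq_iff {r : ℕ} (hr : r ≠ 0) (a : Fin n) :
    (T.1 a).1.1 = r ↔ a.1 = legEntry T.1 r := by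
  unfold legEntry
  constructor
  · intro h
    have hcell : (T.1 a).1 = (r, 0) := Prod.ext h (hμ.cells _ _ (T.mem a) (by omega)).1
    have hmem : (r, 0) ∈ μ.cells := hcell ▸ (T.1 a).2
    rw [dif_pos hmem, show (⟨(r, 0), hmem⟩ : μ.cells) = T.1 a from Subtype.ext hcell.symm,
      Equiv.symm_apply_apply]
  · intro h
    by_cases hmem : (r, 0) ∈ μ.cells
    · rw [dif_pos hmem] at h
      rw [Fin.ext h, Equiv.apply_symm_apply]
    · rw [dif_neg hmem] at h
      exact absurd a.2 (by omega)

theorem row_eq_zero_iff (a : Fin n) :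
    (T.1 a).1.1 = 0 ↔ a.1 ≠ legEntry T.1 1 ∧ a.1 ≠ legEntry T.1 2 := by
  rw [Ne, Ne, ← hμ.row_eq_iff T one_ne_zero, ← hμ.row_eq_iff T two_ne_zero]
  have := hμ.cells _ _ (T.mem a)
  omega

theorem exists_legEntry_one : ∃ a : Fin n, a.1 = legEntry T.1 1 ∧ (T.1 a).1 = (1, 0) := by
  obtain ⟨a, ha⟩ := T.exists_entry hμ.leg
  exact ⟨a, (hμ.row_eq_iff T one_ne_zero a).1 (by rw [ha]), ha⟩

theorem legEntry_one_lt : legEntry T.1 1 < n := by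
  obtain ⟨a, ha, -⟩ := hμ.exists_legEntry_one T
  exact ha ▸ a.2

theorem legEntry_one_pos : 0 < legEntry T.1 1 := by
  obtain ⟨a, ha, hcell⟩ := hμ.exists_legEntry_one T
  obtain ⟨b, hb⟩ := T.exists_entry (μ.up_left_mem (Nat.zero_le 1) le_rfl hμ.leg)
  have hba : b < a := T.2.2 b a (by rw [hb, hcell]) (by rw [hb, hcell]; exact one_pos)
  rw [← ha]
  exact lt_of_le_of_lt (Nat.zero_le _) hba

theorem legEntry_one_lt_two : legEntry T.1 1 < legEntry T.1 2 := by
  by_cases h : (2, 0) ∈ μ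
  · obtain ⟨a, ha, hcell⟩ := hμ.exists_legEntry_one T
    obtain ⟨b, hb⟩ := T.exists_entry h
    rw [← ha, ← (hμ.row_eq_iff T two_ne_zero b).1 (by rw [hb])]
    exact T.2.2 a b (by rw [hb, hcell]) (by rw [hb, hcell]; exact one_lt_two)
  · rw [show legEntry T.1 2 = n from dif_neg fun h' => h ((YoungDiagram.mem_cells _).1 h')]
    exact hμ.legEntry_one_lt T

theorem card_row {r : ℕ} (hr : r ≠ 0) (a : Fin n) :
    (Finset.univ.filter fun b => b < a ∧ (T.1 b).1.1 = r).card =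
      if legEntry T.1 r < a.1 then 1 else 0 := by
  split_ifs with h
  · rw [Finset.card_eq_one]
    refine ⟨⟨legEntry T.1 r, h.trans a.2⟩, ?_⟩
    ext b
    simp only [Finset.mem_filter, Finset.mem_univ, true_and, Finset.mem_singleton, Fin.ext_iff,
      hμ.row_eq_iff T hr, Fin.lt_def]
    omega
  · rw [Finset.card_eq_zero]
    ext b
    simp only [Finset.mem_filter, Finset.mem_univ, true_and, hμ.row_eq_iff T hr, Fin.lt_def,
      Finset.notMem_empty, iff_false]
    omega

theorem col_add {a : Fin n} (ha : (T.1 a).1.1 = 0) :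
    (T.1 a).1.2 + (if legEntry T.1 1 < a.1 then 1 else 0) +
      (if legEntry T.1 2 < a.1 then 1 else 0) = a.1 := by
  rw [T.col_eq_card, ← hμ.card_row T one_ne_zero, ← hμ.card_row T two_ne_zero, ha]
  have hcard : (Finset.univ.filter fun b => b < a).card = a.1 := by
    rw [← Fin.card_Iio a]
    congr 1
    ext b
    simp
  rw [← hcard]
  simp only [Finset.card_filter, ← Finset.sum_add_distrib]
  refine Finset.sum_congr rfl fun b _ => ?_
  have hb := hμ.cells _ _ (T.mem b)
  by_cases hba : b < a
  · simp only [hba, true_and, if_true]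
    obtain h | h | h : (T.1 b).1.1 = 0 ∨ (T.1 b).1.1 = 1 ∨ (T.1 b).1.1 = 2 := by omega
    all_goals simp [h]
  · simp [hba]

theorem content_eq (a : Fin n) :
    tableauContent T a = hookContent (legEntry T.1 1) (legEntry T.1 2) a.1 := by
  unfold tableauContent hookContent
  by_cases h1 : a.1 = legEntry T.1 1
  · have hr := (hμ.row_eq_iff T one_ne_zero a).2 h1
    have hc := (hμ.cells _ _ (T.mem a) (by omega)).1
    rw [if_pos h1, hr, hc]
    rfl
  rw [if_neg h1]
  by_cases h2 : a.1 = legEntry T.1 2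
  · have hr := (hμ.row_eq_iff T two_ne_zero a).2 h2
    have hc := (hμ.cells _ _ (T.mem a) (by omega)).1
    rw [if_pos h2, hr, hc]
    rfl
  rw [if_neg h2]
  have hr := (hμ.row_eq_zero_iff T a).2 ⟨h1, h2⟩
  have hc := hμ.col_add T hr
  rw [hr]
  split_ifs at hc ⊢ <;> push_cast <;> omega

theorem ext_legEntry {S T : StandardTableau n μ} (h1 : legEntry S.1 1 = legEntry T.1 1)
    (h2 : legEntry S.1 2 = legEntry T.1 2) : S = T := by
  refine Subtype.ext (Equiv.ext fun a => Subtype.ext ?_)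
  have hrow : (S.1 a).1.1 = (T.1 a).1.1 := by
    by_cases e1 : a.1 = legEntry T.1 1
    · rw [(hμ.row_eq_iff T one_ne_zero a).2 e1, (hμ.row_eq_iff S one_ne_zero a).2 (h1 ▸ e1)]
    by_cases e2 : a.1 = legEntry T.1 2
    · rw [(hμ.row_eq_iff T two_ne_zero a).2 e2, (hμ.row_eq_iff S two_ne_zero a).2 (h2 ▸ e2)]
    rw [(hμ.row_eq_zero_iff T a).2 ⟨e1, e2⟩,
      (hμ.row_eq_zero_iff S a).2 ⟨h1 ▸ e1, h2 ▸ e2⟩]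
  have hcont : tableauContent S a = tableauContent T a := by
    rw [hμ.content_eq, hμ.content_eq, h1, h2]
  unfold tableauContent at hcont
  exact Prod.ext hrow (by omega)

theorem legEntry_of_isTerminal {T : StandardTableau n μ} (hT : IsTerminal T) {k : Fin (n - 1)}
    (hk : k.1 + 2 = n) :
    ((2, 0) ∉ μ ∧ legEntry T.1 1 = k.1 + 1 ∧ legEntry T.1 2 = n) ∨
      ((2, 0) ∈ μ ∧ legEntry T.1 1 = k.1 ∧ legEntry T.1 2 = k.1 + 1) := by
  have hlt := hμ.legEntry_one_lt_two T
  have hge : k.1 ≤ legEntry T.1 1 := by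
    by_contra! h
    obtain ⟨a, ha, hcell⟩ := hμ.exists_legEntry_one T
    have := hT.1 a (by omega)
    rw [hcell] at this
    exact one_ne_zero this
  by_cases h : (2, 0) ∈ μ
  · right
    obtain ⟨b, hb⟩ := T.exists_entry h
    have hb' := (hμ.row_eq_iff T two_ne_zero b).1 (by rw [hb])
    have := b.2
    exact ⟨h, by omega, by omega⟩
  · left
    have h2 : legEntry T.1 2 = n := dif_neg fun h' => h ((YoungDiagram.mem_cells _).1 h')
    refine ⟨h, ?_, h2⟩
    have hup := (hT.2 k hk).1
    rw [Ne, hμ.row_eq_zero_iff] at hup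
    by_contra hne
    exact hup ⟨fun e => hne e.symm, fun e => by
      rw [h2] at e
      exact absurd (upperEntry k).2 (by omega)⟩

theorem isTerminal_unique {S T : StandardTableau n μ} (hS : IsTerminal S) (hT : IsTerminal T)
    {k : Fin (n - 1)} (hk : k.1 + 2 = n) : S = T := by
  rcases hμ.legEntry_of_isTerminal hS hk with ⟨h, h1, h2⟩ | ⟨h, h1, h2⟩ <;>
  rcases hμ.legEntry_of_isTerminal hT hk with ⟨h', h1', h2'⟩ | ⟨h', h1', h2'⟩
  · exact hμ.ext_legEntry (h1.trans h1'.symm) (h2.trans h2'.symm)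
  · exact absurd h' h
  · exact absurd h h'
  · exact hμ.ext_legEntry (h1.trans h1'.symm) (h2.trans h2'.symm)

theorem isAlternatingFamily : IsAlternatingFamily (hookPairVector (n := n) μ) where
  equivariant k i j := by
    have hval : ∀ a : Fin n, (adjacentSwap k a).1 = natAdjacentSwap k.1 a.1 := fun a => by
      rw [adjacentSwap_apply_val, natAdjacentSwap_apply]
    let F : (Fin n ≃ μ.cells) → ℝ := fun T =>
      wedgeCoordinate (legEntry T 1) (legEntry T 2) i.1 j.1
    have hF : hookPairVector μ i j = fun T : StandardTableau n μ => F T.1 := rfl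
    rw [hF, youngGenerator_mulVec]
    funext T
    have hd : axialDistance T k = hookContent (legEntry T.1 1) (legEntry T.1 2) (k.1 + 1) -
        hookContent (legEntry T.1 1) (legEntry T.1 2) k.1 := by
      unfold axialDistance
      rw [hμ.content_eq, hμ.content_eq]
      rfl
    have := wedgeCoordinate_swap (hμ.legEntry_one_lt_two T) hd i.1 j.1
    rw [← hval, ← hval, ← legEntry_trans, ← legEntry_trans] at this
    exact this
  alternating i j := by
    funext T
    simp only [hookPairVector, wedgeCoordinate, Pi.neg_apply]
    ring

theorem hookPairVector_terminal_ne_zero {T : StandardTableau n μ} (hT : IsTerminal T)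
    {k : Fin (n - 1)} (hk : k.1 + 2 = n) :
    hookPairVector μ (upperEntry k) (lowerEntry k) T ≠ 0 := by
  have hpos := hμ.legEntry_one_pos T
  have hc1 := gelfandTsetlinScale_ne_zero hpos
  have hc2 := gelfandTsetlinScale_ne_zero (hpos.trans (hμ.legEntry_one_lt_two T))
  have key : hookPairVector μ (upperEntry k) (lowerEntry k) T =
      gelfandTsetlinScale (legEntry T.1 1) * gelfandTsetlinScale (legEntry T.1 2) *
        (gelfandTsetlin (legEntry T.1 1) (k.1 + 1) * gelfandTsetlin (legEntry T.1 2) k.1 -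
          gelfandTsetlin (legEntry T.1 1) k.1 * gelfandTsetlin (legEntry T.1 2) (k.1 + 1)) := by
    simp only [hookPairVector, wedgeCoordinate, unitGelfandTsetlin, upperEntry, lowerEntry]
    ring
  rw [key]
  refine mul_ne_zero (mul_ne_zero hc1 hc2) ?_
  unfold gelfandTsetlin
  have hk0 : (0 : ℝ) ≤ k.1 := Nat.cast_nonneg _
  rcases hμ.legEntry_of_isTerminal hT hk with ⟨-, h1, h2⟩ | ⟨-, h1, h2⟩
  · rw [h1, h2, if_neg (lt_irrefl _), if_pos rfl, if_pos (by omega), if_pos (by omega),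
      if_pos (by omega)]
    push_cast
    intro e
    linarith
  · rw [h1] at hpos
    have hk1 : (0 : ℝ) < k.1 := by exact_mod_cast hpos
    rw [h1, h2, if_neg (by omega), if_neg (by omega), if_pos (by omega), if_neg (lt_irrefl _),
      if_pos rfl, if_neg (lt_irrefl _), if_pos rfl]
    push_cast
    intro e
    nlinarith

theorem sum_hookPairVector_ne_zero (T : StandardTableau n μ) :
    ∑ j : Fin n, ∑ i ∈ Finset.Ioi j, hookPairVector μ i j T ≠ 0 := by
  have hpos := hμ.legEntry_one_pos T
  have hlt := hμ.legEntry_one_lt_two T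
  unfold hookPairVector
  rw [sum_fin_Ioi_eq_sum_range fun i j => wedgeCoordinate (legEntry T.1 1) (legEntry T.1 2) i j,
    sum_range_wedgeCoordinate hlt, if_pos (hμ.legEntry_one_lt T)]
  have hk : (0 : ℝ) < legEntry T.1 1 := by exact_mod_cast hpos
  exact neg_ne_zero.2 (mul_ne_zero (mul_ne_zero (gelfandTsetlinScale_ne_zero hpos)
    (gelfandTsetlinScale_ne_zero (hpos.trans hlt))) (by positivity))

/-- Every row of the Fourier coefficient is a multiple of one vector that does not depend on the
instance, namely the sum of `hookPairVector μ i j` over the positions `j < i`. -/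
theorem exists_fourierCoefficient_row_factor (A : Matrix (Fin n) (Fin n) ℝ)
    (R : StandardTableau n μ) :
    ∃ u : ℝ, ∀ T, fourierCoefficient (lopObjective A) μ R T =
      u * ∑ j : Fin n, ∑ i ∈ Finset.Ioi j, hookPairVector μ i j T := by
  have hn : 2 ≤ n := by
    have h1 := hμ.legEntry_one_lt R
    have h2 := hμ.legEntry_one_pos R
    omega
  let k : Fin (n - 1) := ⟨n - 2, by omega⟩
  have hk : k.1 + 2 = n := Nat.sub_add_cancel hn
  have hrows : ∀ T : StandardTableau n μ, ∃ a, (T.1 a).1.1 ≠ 0 := fun T => by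
    obtain ⟨a, -, ha⟩ := hμ.exists_legEntry_one T
    exact ⟨a, by rw [ha]; exact one_ne_zero⟩
  let r : Fin n → Fin n → StandardTableau n μ → ℝ := fun i j =>
    (pairCoefficient μ A i j - pairCoefficient μ A j i) R
  have hr : IsAlternatingFamily r := isAlternatingFamily_pairCoefficient A R
  have hsum : ∀ T, 2 * fourierCoefficient (lopObjective A) μ R T =
      ∑ j : Fin n, ∑ i ∈ Finset.Ioi j, r i j T := by
    intro T
    have := congrFun (congrFun (two_smul_fourierCoefficient A hrows) R) T
    simpa only [Matrix.smul_apply, smul_eq_mul, Matrix.sum_apply] using this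
  by_cases hT : ∃ T₀ : StandardTableau n μ, IsTerminal T₀
  · obtain ⟨T₀, hT₀⟩ := hT
    have hne := hμ.hookPairVector_terminal_ne_zero hT₀ hk
    have hprop := hr.proportional hμ.isAlternatingFamily hk
      (T₀ := T₀) fun T hT => hμ.isTerminal_unique hT hT₀ hk
    refine ⟨r (upperEntry k) (lowerEntry k) T₀ /
      (2 * hookPairVector μ (upperEntry k) (lowerEntry k) T₀), fun T => ?_⟩
    have hs : hookPairVector μ (upperEntry k) (lowerEntry k) T₀ *
        (2 * fourierCoefficient (lopObjective A) μ R T) =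
        r (upperEntry k) (lowerEntry k) T₀ *
          ∑ j : Fin n, ∑ i ∈ Finset.Ioi j, hookPairVector μ i j T := by
      rw [hsum]
      simp only [Finset.mul_sum]
      exact Finset.sum_congr rfl fun j _ => Finset.sum_congr rfl fun i _ =>
        congrFun (hprop i j) T
    rw [div_mul_eq_mul_div, eq_div_iff (mul_ne_zero two_ne_zero hne), ← hs]
    ring
  · refine ⟨0, fun T => ?_⟩
    have h := hsum T
    rw [Finset.sum_eq_zero fun j _ => Finset.sum_eq_zero fun i _ => congrFun
      (hr.eq_zero_of_terminal hk (fun S hS => absurd ⟨S, hS⟩ hT) i j) T] at h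
    linarith

end IsShortHook

end ShortHooks

theorem Matrix.rank_eq_one_iff_of_col_proportional {m : Type*} [Fintype m] {M : Matrix m m ℝ}
    (hM : M.rank ≤ 1) {c : m → m → ℝ} (hc : ∀ s t, M.col t = c s t • M.col s) :
    M.rank = 1 ↔ ∃ s, M.col s ≠ 0 ∧ ∀ t, ∃ a : ℝ, M.col t = a • M.col s := by
  classical
  constructor
  · intro h
    by_contra! hs
    have h0 : M = 0 := by
      ext i s
      by_contra hne
      obtain ⟨t, ht⟩ := hs s fun e => hne (congrFun e i)
      exact ht _ (hc s t)
    rw [h0, Matrix.rank_zero] at h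
    exact zero_ne_one h
  · rintro ⟨s, hs, -⟩
    refine le_antisymm hM (Nat.one_le_iff_ne_zero.2 fun h => hs ?_)
    rw [Matrix.rank_eq_finrank_span_cols, Submodule.finrank_eq_zero, Submodule.span_eq_bot] at h
    exact h _ ⟨s, rfl⟩

theorem theorem1 (n : ℕ) :
    (∀ (A : Matrix (Fin n) (Fin n) ℝ) (μ : YoungDiagram), μ.card = n →
      μ.rowLens ≠ [n] → μ.rowLens ≠ [n - 1, 1] → μ.rowLens ≠ [n - 2, 1, 1] →
        fourierCoefficient (lopObjective A) μ = 0) ∧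
    (∀ μ : YoungDiagram, μ.card = n →
      (μ.rowLens = [n - 1, 1] ∨ μ.rowLens = [n - 2, 1, 1]) →
        (∀ A : Matrix (Fin n) (Fin n) ℝ,
          (fourierCoefficient (lopObjective A) μ).rank ≤ 1 ∧
          ((fourierCoefficient (lopObjective A) μ).rank = 1 ↔
            ∃ s, (fourierCoefficient (lopObjective A) μ).col s ≠ 0 ∧
              ∀ t, ∃ a : ℝ, (fourierCoefficient (lopObjective A) μ).col t =
                a • (fourierCoefficient (lopObjective A) μ).col s)) ∧
        ∃ c : StandardTableau n μ → StandardTableau n μ → ℝ,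
          ∀ (A : Matrix (Fin n) (Fin n) ℝ) (s t : StandardTableau n μ),
            (fourierCoefficient (lopObjective A) μ).col t =
              c s t • (fourierCoefficient (lopObjective A) μ).col s) := by
  refine ⟨fun A μ _ h1 h2 h3 => fourierCoefficient_eq_zero A h1 h2 h3, fun μ _ hshape => ?_⟩
  have hμ : IsShortHook μ := hshape.elim (fun h => isShortHook_of_rowLens (Or.inl h))
    fun h => isShortHook_of_rowLens (Or.inr h)
  let w : StandardTableau n μ → ℝ := fun T =>
    ∑ j : Fin n, ∑ i ∈ Finset.Ioi j, hookPairVector μ i j T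
  have hcol : ∀ (A : Matrix (Fin n) (Fin n) ℝ) (s t : StandardTableau n μ),
      (fourierCoefficient (lopObjective A) μ).col t =
        (w t / w s) • (fourierCoefficient (lopObjective A) μ).col s := by
    intro A s t
    funext R
    obtain ⟨u, hu⟩ := hμ.exists_fourierCoefficient_row_factor A R
    rw [Pi.smul_apply, Matrix.col_apply, Matrix.col_apply, hu, hu, smul_eq_mul]
    have hs : w s ≠ 0 := hμ.sum_hookPairVector_ne_zero s
    change u * w t = w t / w s * (u * w s)
    field_simp
  refine ⟨fun A => ?_, fun s t => w t / w s, hcol⟩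
  have hrank : (fourierCoefficient (lopObjective A) μ).rank ≤ 1 := by
    choose u hu using hμ.exists_fourierCoefficient_row_factor A
    have : fourierCoefficient (lopObjective A) μ = Matrix.vecMulVec u w := by
      ext R T
      exact hu R T
    rw [this]
    exact Matrix.rank_vecMulVec_le u w
  exact ⟨hrank, Matrix.rank_eq_one_iff_of_col_proportional hrank (hcol A)⟩
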